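/- Let $K$ be a field and let $n_1,n_2$ be positive integers. Let $L=L_2(n_1,n_2)$ be the finite lattice $\{s,x_{1,1},\dots,x_{1,n_1},x_{2,1},\dots,x_{2,n_2},t\}$ with $s<x_{i,1}<\cdots<x_{i,n_i}<t$ for $i=1,2$, where $x_{1,p}$ and $x_{2,q}$ are incomparable for all $p,q$. Let $R=R_{n_1,n_2}=K[L]$ be the standard graded polynomial ring whose variables are the elements of $L$, let $$I_L=\bigl(\,ab-(a\vee b)(a\wedge b)\;:\;a,b\in L\,\bigr)\subset R$$ be the join-meet ideal of $L$, and let $\mathrm{in}_\prec(I_L)$ be its initial ideal with respect to the graded reverse lexicographic order $\prec$ induced by $$s\prec x_{1,1}\prec\cdots\prec x_{1,n_1}\prec x_{2,1}\prec\cdots\prec x_{2,n_2}\prec t .$$ (So $u\prec v$ for monomials $u,v$ if and only if $\deg u<\deg v$, or $\deg u=\deg v$ and the smallest variable in which $u$ and $v$ differ has the larger exponent in $u$.) Then $$\max\{n_1,n_2\}\;\le\;\operatorname{projdim}_R\bigl(R/\mathrm{in}_\prec(I_L)\bigr)\;\le\;n_1+n_2+1 .$$ Moreover, $R/\mathrm{in}_\prec(I_L)$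 has a minimal graded free resolution $\cdots\to F_2\to F_1\to F_0\to R/\mathrm{in}_\prec(I_L)\to 0$ with finitely generated $F_i=\bigoplus_j R(-j)^{B_{i,j}}$, and in every such resolution the total Betti numbers satisfy $$\binom{n_1}{i}\;\le\;\sum_{j=0}^{\infty}B_{i,j}\qquad\text{for } i=1,2,\dots,n_1 .$$ -/

import Mathlib

open MvPolynomial

noncomputable section

/-! ### The crystal lattice with two chains -/

/-- The elements `s`, `x i = x_{1,i+1}` (`i < n₁`), `y j = x_{2,j+1}` (`j < n₂`) and `t`
of the crystal lattice `L₂(n₁, n₂)`. -/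
inductive CrystalLattice (n₁ n₂ : ℕ) : Type
  | s : CrystalLattice n₁ n₂
  | x (i : Fin n₁) : CrystalLattice n₁ n₂
  | y (j : Fin n₂) : CrystalLattice n₁ n₂
  | t : CrystalLattice n₁ n₂

namespace CrystalLattice

variable {n₁ n₂ : ℕ}

/-- The order with `s < x 0 < ⋯ < x (n₁ - 1) < t` and `s < y 0 < ⋯ < y (n₂ - 1) < t`,
the two chains being incomparable with each other. -/
def Le : CrystalLattice n₁ n₂ → CrystalLattice n₁ n₂ → Prop
  | s, _ => True
  | _, t => True
  | x i, x i' => i ≤ i'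
  | y j, y j' => j ≤ j'
  | _, _ => False

/-- The join. -/
def join : CrystalLattice n₁ n₂ → CrystalLattice n₁ n₂ → CrystalLattice n₁ n₂
  | s, b => b
  | a, s => a
  | x i, x i' => x (max i i')
  | y j, y j' => y (max j j')
  | _, _ => t

/-- The meet. -/
def meet : CrystalLattice n₁ n₂ → CrystalLattice n₁ n₂ → CrystalLattice n₁ n₂
  | t, b => b
  | a, t => a
  | x i, x i' => x (min i i')
  | y j, y j' => y (min j j')
  | _, _ => s

instance instLattice : Lattice (CrystalLattice n₁ n₂) where
  le := Le
  sup := join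
  inf := meet
  le_refl a := by cases a <;> simp [Le]
  le_trans a b c := by
    cases a <;> cases b <;> cases c <;> simp [Le] <;> exact fun h h' => le_trans h h'
  le_antisymm a b := by
    cases a <;> cases b <;> simp [Le] <;> exact fun h h' => le_antisymm h h'
  le_sup_left a b := by cases a <;> cases b <;> simp [Le, join]
  le_sup_right a b := by cases a <;> cases b <;> simp [Le, join]
  sup_le a b c := by
    cases a <;> cases b <;> cases c <;> simp [Le, join] <;> exact fun h h' => ⟨h, h'⟩
  inf_le_left a b := by cases a <;> cases b <;> simp [Le, meet]
  inf_le_right a b := by cases a <;> cases b <;> simp [Le, meet]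
  le_inf a b c := by
    cases a <;> cases b <;> cases c <;> simp [Le, meet] <;> exact fun h h' => ⟨h, h'⟩

/-- The position of each variable in the list
`s, x_{1,1}, …, x_{1,n₁}, x_{2,1}, …, x_{2,n₂}, t`. -/
def position : CrystalLattice n₁ n₂ → Fin (n₁ + n₂ + 2)
  | s => ⟨0, by omega⟩
  | x i => ⟨i + 1, by omega⟩
  | y j => ⟨n₁ + j + 1, by omega⟩
  | t => ⟨n₁ + n₂ + 1, by omega⟩

theorem position_injective :
    Function.Injective (position : CrystalLattice n₁ n₂ → Fin (n₁ + n₂ + 2)) := by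
  intro a b h
  cases a <;> cases b <;> simp only [position, Fin.mk.injEq] at h <;>
    first
      | rfl
      | (exfalso; omega)
      | (congr 1; ext; omega)

instance instFinite : Finite (CrystalLattice n₁ n₂) :=
  Finite.of_injective position position_injective

/-- The total order of the variables
`s ≺ x_{1,1} ≺ ⋯ ≺ x_{1,n₁} ≺ x_{2,1} ≺ ⋯ ≺ x_{2,n₂} ≺ t`. It is not the order of the lattice. -/
@[reducible]
def variableOrder (n₁ n₂ : ℕ) : LinearOrder (CrystalLattice n₁ n₂) :=
  LinearOrder.lift' position position_injective

end CrystalLattice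

/-! ### The join-meet ideal of a lattice -/

/-- The join-meet ideal of a lattice `L` in the polynomial ring whose variables are
the elements of `L`. -/
def joinMeetIdeal (K : Type*) [Field K] (L : Type*) [Lattice L] : Ideal (MvPolynomial L K) :=
  Ideal.span {f | ∃ a b : L, f = X a * X b - X (a ⊔ b) * X (a ⊓ b)}

/-! ### The (graded) reverse lexicographic monomial order and initial ideals -/

/-- Exponent vectors, to be ordered by the graded reverse lexicographic order. -/
def DegRevLex (σ : Type*) : Type _ := σ →₀ ℕ

namespace DegRevLex

variable {σ : Type*}

instance : AddCommMonoid (DegRevLex σ) := inferInstanceAs (AddCommMonoid (σ →₀ ℕ))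

/-- The identity map from exponent vectors to their ordered copy. -/
def equiv (σ : Type*) : (σ →₀ ℕ) ≃+ DegRevLex σ := AddEquiv.refl _

/-- The sort key of the order: first the total degree, then the exponents, read from the smallest
variable on, a larger exponent making the monomial smaller. -/
def key (a : DegRevLex σ) : ℕ ×ₗ Lex (σ → ℕᵒᵈ) :=
  toLex (((equiv σ).symm a).degree, toLex fun i => OrderDual.toDual ((equiv σ).symm a i))

theorem key_injective : Function.Injective (key : DegRevLex σ → _) := by
  intro a b h
  apply (equiv σ).symm.injective
  ext i
  exact congrFun (congrArg (fun p => (ofLex p).2) h) i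

variable [LinearOrder σ] [Finite σ]

instance : LinearOrder (DegRevLex σ) := LinearOrder.lift' key key_injective

/-- `a ≺ b` if and only if `deg a < deg b`, or the degrees agree and the smallest variable in which
`a` and `b` differ has the larger exponent in `a`. -/
theorem equiv_lt_iff {a b : σ →₀ ℕ} :
    equiv σ a < equiv σ b ↔ a.degree < b.degree ∨
      (a.degree = b.degree ∧ ∃ i, (∀ j < i, a j = b j) ∧ b i < a i) := by
  change key (equiv σ a) < key (equiv σ b) ↔ _
  rw [key, key, Prod.Lex.toLex_lt_toLex]
  rfl

instance : IsOrderedAddMonoid (DegRevLex σ) := by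
  have h : ∀ a b c : σ →₀ ℕ, equiv σ a ≤ equiv σ b → equiv σ (c + a) ≤ equiv σ (c + b) := by
    intro a b c hab
    rcases hab.eq_or_lt with hab | hab
    · rw [(equiv σ).injective hab]
    · apply le_of_lt
      rw [equiv_lt_iff] at hab ⊢
      rcases hab with hab | ⟨hab, i, hi, hi'⟩
      · left; simpa using hab
      · right
        refine ⟨by simpa using hab, i, fun j hj => by simp [hi j hj], by simpa using hi'⟩
  constructor
  · intro a b hab c
    have := h ((equiv σ).symm a) ((equiv σ).symm b) ((equiv σ).symm c) hab
    rw [add_comm a, add_comm b]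
    exact this
  · intro a b hab c
    exact h ((equiv σ).symm a) ((equiv σ).symm b) ((equiv σ).symm c) hab

theorem equiv_monotone : Monotone (equiv σ) := by
  intro a b hab
  rcases hab.eq_or_lt with rfl | hlt
  · exact le_rfl
  · apply le_of_lt
    rw [equiv_lt_iff]
    left
    obtain ⟨c, rfl⟩ := exists_add_of_le hab
    have hc : c ≠ 0 := by rintro rfl; simp at hlt
    have : c.degree ≠ 0 := by rwa [Ne, Finsupp.degree_eq_zero_iff]
    rw [map_add]
    omega

instance : WellFoundedLT (DegRevLex σ) := by
  have : WellQuasiOrderedLE (DegRevLex σ) := by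
    constructor
    intro f
    obtain ⟨m, n, hmn, h⟩ :=
      (WellQuasiOrderedLE.wqo (α := σ →₀ ℕ)) (fun n => (equiv σ).symm (f n))
    exact ⟨m, n, hmn, by simpa using equiv_monotone h⟩
  infer_instance

end DegRevLex

/-- The graded reverse lexicographic monomial order on monomials in totally ordered variables. -/
def degRevLex (σ : Type*) [LinearOrder σ] [Finite σ] : MonomialOrder σ where
  syn := DegRevLex σ
  toSyn := DegRevLex.equiv σ
  toSyn_monotone := DegRevLex.equiv_monotone

/-- The reverse lexicographic order induced by
`s ≺ x_{1,1} ≺ ⋯ ≺ x_{1,n₁} ≺ x_{2,1} ≺ ⋯ ≺ x_{2,n₂} ≺ t`. -/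
def crystalMonomialOrder (n₁ n₂ : ℕ) : MonomialOrder (CrystalLattice n₁ n₂) :=
  @degRevLex (CrystalLattice n₁ n₂) (CrystalLattice.variableOrder n₁ n₂) inferInstance

/-- The initial ideal of an ideal of a polynomial ring over a field with respect to a monomial
order, generated by the leading terms of all elements of the ideal. -/
def initialIdeal {K : Type*} [Field K] {σ : Type*} (m : MonomialOrder σ)
    (I : Ideal (MvPolynomial σ K)) : Ideal (MvPolynomial σ K) :=
  Ideal.span (m.leadingTerm '' (I : Set (MvPolynomial σ K)))

/-- The ideal `in_≺(I_{L₂(n₁, n₂)})`. -/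
def crystalInitialIdeal (K : Type*) [Field K] (n₁ n₂ : ℕ) :
    Ideal (MvPolynomial (CrystalLattice n₁ n₂) K) :=
  initialIdeal (crystalMonomialOrder n₁ n₂) (joinMeetIdeal K (CrystalLattice n₁ n₂))

/-! ### Minimal graded free resolutions and Betti numbers -/

/-- A minimal graded free resolution `⋯ → F₂ → F₁ → F₀ → R ⧸ J → 0` over the standard graded
polynomial ring `R`, where `Fᵢ` is free on finitely many homogeneous generators and all maps are
homogeneous of degree zero. -/
structure MinimalGradedFreeResolution {K : Type*} [Field K] {σ : Type*}
    (J : Ideal (MvPolynomial σ K)) where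
  /-- The rank of `Fᵢ`. -/
  rank : ℕ → ℕ
  /-- The degrees of the generators of `Fᵢ`, so that `Fᵢ = ⨁ c, R(-deg i c)`. -/
  deg : (i : ℕ) → Fin (rank i) → ℕ
  /-- The augmentation `F₀ → R ⧸ J`. -/
  aug : (Fin (rank 0) → MvPolynomial σ K) →ₗ[MvPolynomial σ K] (MvPolynomial σ K ⧸ J)
  /-- The differentials `Fᵢ₊₁ → Fᵢ`. -/
  d : (i : ℕ) → (Fin (rank (i + 1)) → MvPolynomial σ K) →ₗ[MvPolynomial σ K]
    (Fin (rank i) → MvPolynomial σ K)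
  aug_homogeneous : ∀ c, ∃ p : MvPolynomial σ K,
    p.IsHomogeneous (deg 0 c) ∧ aug (Pi.single c 1) = Ideal.Quotient.mk J p
  /-- The entry of the matrix of `d i` in position `(r, c)` is homogeneous of degree
  `deg (i + 1) c - deg i r`, and zero if this is negative. -/
  d_homogeneous : ∀ i c r, ∀ a ∈ (d i (Pi.single c 1) r).support,
    a.degree + deg i r = deg (i + 1) c
  aug_surjective : Function.Surjective aug
  exact_zero : Function.Exact (d 0) aug
  exact_succ : ∀ i, Function.Exact (d (i + 1)) (d i)
  /-- Minimality: the image of `Fᵢ₊₁` lies in `𝔪 Fᵢ`, with `𝔪` the ideal of all polynomials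
  without constant term. -/
  minimal : ∀ i v r, constantCoeff (d i v r) = 0

namespace MinimalGradedFreeResolution

variable {K : Type*} [Field K] {σ : Type*} {J : Ideal (MvPolynomial σ K)}

/-- The graded Betti number `B_{i,j}`: the number of summands `R(-j)` in `Fᵢ`. -/
def gradedBetti (F : MinimalGradedFreeResolution J) (i j : ℕ) : ℕ :=
  Fintype.card {c : Fin (F.rank i) // F.deg i c = j}

/-- The `i`-th total Betti number `∑_j B_{i,j}`. -/
def totalBetti (F : MinimalGradedFreeResolution J) (i : ℕ) : ℕ :=
  ∑ᶠ j, F.gradedBetti i j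

end MinimalGradedFreeResolution

end

/-! Write `J` for the initial ideal. The relations give `s t x_p = s t x_0` and `s t y_q = s t y_0`
modulo the join-meet ideal. Accordingly `J` is the monomial ideal generated by all `x_p y_q` and by
the `s t x_p`, `s t y_q` with `p`, `q` not the first index (`mem_crystalInitialIdeal_iff`). That
nothing else is needed follows from an explicit normal form for monomials, constant on congruence
classes and never larger than the monomial itself.

Let `P₁` and `P₂` be the ideals generated by the variables of the two chains. Let `P₁⁺` be `P₁` with
the `y_q`, `q ≠ 0`, adjoined, and define `P₂⁺` likewise. Then `J = (P₁ + (st)) ∩ P₁⁺ ∩ (P₂ + (st)) ∩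
P₂⁺` (`crystalInitialIdeal_eq_inf`). The four ideals and the sums that occur are generated by
regular sequences of variables, possibly followed by `st`, so Mayer–Vietoris sequences give the
upper bound.

For the lower bounds, look at `J` near the point where `s`, `t`, `y_0` are `1` and all other
variables are `0`. There `s t y_0` is invertible and `J` agrees with `P₁⁺`, which is generated by
`n₁ + n₂ - 1` variables. With `N` the residue field of this point, `Extⁱ(R/P₁⁺, N)` embeds into
`Extⁱ(R/J, N)` and has length at least `(n₁ + n₂ - 1).choose i`, by Pascal's rule along the
variables. Nonvanishing in the top degree bounds the projective dimension from below. The length of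
`Extⁱ` is at most the rank of `Fᵢ`, which bounds the Betti numbers; neither minimality nor grading
is used for this.

A minimal graded resolution exists because one can repeatedly cover a graded syzygy module by the
least possible number of homogeneous generators. -/

noncomputable section

/-! ### Lengths of Ext modules and projective dimension along short exact sequences -/

section ExtLength

open CategoryTheory Abelian

universe u

variable {R : Type u} [CommRing R]

theorem ModuleCat.subsingleton_ext_succ_of_projective (M : Type u) [AddCommGroup M] [Module R M]
    [Module.Projective R M] (N : ModuleCat.{u} R) (i : ℕ) :
    Subsingleton (Ext (ModuleCat.of R M) N (i + 1)) :=
  have : CategoryTheory.Projective (ModuleCat.of R M) :=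
    (IsProjective.iff_projective _).1 inferInstance
  Ext.subsingleton_of_projective _ _ _

/-- `Ext⁰` is the module of linear maps. -/
def ModuleCat.extZeroLinearEquiv (M : Type u) [AddCommGroup M] [Module R M]
    (N : ModuleCat.{u} R) : Ext (ModuleCat.of R M) N 0 ≃ₗ[R] (M →ₗ[R] N) :=
  Ext.linearEquiv₀.trans (ModuleCat.homLinearEquiv (S := R))

theorem Module.length_linearMap_fin_fun (N : Type u) [AddCommGroup N] [Module R N]
    [IsSimpleModule R N] (r : ℕ) : Module.length R ((Fin r → R) →ₗ[R] N) = r := by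
  rw [← ((Pi.basisFun R (Fin r)).constr R : (Fin r → N) ≃ₗ[R] _).length_eq,
    Module.length_pi_of_fintype]
  simp [Module.length_eq_one]

/-- The rank of the `i`-th term of a free resolution of `M` bounds the length of `Extⁱ(M, N)` for
every simple module `N`. -/
theorem ModuleCat.length_ext_le_rank (N : ModuleCat.{u} R) [IsSimpleModule R N] (i : ℕ) :
    ∀ (M : Type u) [AddCommGroup M] [Module R M] (rank : ℕ → ℕ)
      (aug : (Fin (rank 0) → R) →ₗ[R] M)
      (d : (i : ℕ) → (Fin (rank (i + 1)) → R) →ₗ[R] (Fin (rank i) → R)),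
      Function.Surjective aug → Function.Exact (d 0) aug →
      (∀ i, Function.Exact (d (i + 1)) (d i)) →
      Module.length R (Ext (ModuleCat.of R M) N i) ≤ rank i := by
  induction i with
  | zero =>
    intro M _ _ rank aug d haug _ _
    rw [(ModuleCat.extZeroLinearEquiv M N).length_eq,
      ← Module.length_linearMap_fin_fun (R := R) N (rank 0)]
    refine Module.length_le_of_injective (LinearMap.lcomp R N aug) fun f g h => ?_
    ext m
    obtain ⟨v, rfl⟩ := haug m
    exact LinearMap.congr_fun h v
  | succ i ih =>
    intro M _ _ rank aug d haug h0 hs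
    have hmem : ∀ v, d 0 v ∈ LinearMap.ker aug := fun v => (h0 _).2 ⟨v, rfl⟩
    -- Dimension shift: the tail of the resolution resolves the first syzygy module `ker aug`.
    refine le_trans ?_ (ih (LinearMap.ker aug) (fun j => rank (j + 1))
      ((d 0).codRestrict _ hmem) (fun j => d (j + 1)) ?_ ?_ fun j => hs (j + 1))
    · have hS := LinearMap.shortExact_shortComplexKer haug
      refine Module.length_le_of_surjective
        (Ext.precompOfLinear hS.extClass R N (add_comm 1 i)) fun x => ?_
      have := ModuleCat.subsingleton_ext_succ_of_projective (Fin (rank 0) → R) N i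
      -- The connecting map is onto because the next term of the long exact sequence is a positive
      -- Ext of a free module.
      exact Ext.contravariant_sequence_exact₃ hS N x (Subsingleton.elim _ _) (add_comm 1 i)
    · rintro ⟨v, hv⟩
      obtain ⟨w, rfl⟩ := (h0 v).1 hv
      exact ⟨w, rfl⟩
    · intro v
      rw [← hs 0 v]
      exact Subtype.ext_iff

theorem ModuleCat.ext_smul_eq_zero {N : ModuleCat.{u} R} {r : R} (hr : ∀ n : N, r • n = 0)
    {M : ModuleCat.{u} R} {i : ℕ} (x : Ext M N i) : r • x = 0 := by
  have : r • 𝟙 N = 0 := by ext n; exact hr n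
  rw [Ext.smul_eq_comp_mk₀, this, Ext.mk₀_zero, Ext.comp_zero]

theorem ModuleCat.ext_smul_eq_self {N : ModuleCat.{u} R} {r : R} (hr : ∀ n : N, r • n = n)
    {M : ModuleCat.{u} R} {i : ℕ} (x : Ext M N i) : r • x = x := by
  have : r • 𝟙 N = 𝟙 N := by ext n; exact hr n
  rw [Ext.smul_eq_comp_mk₀, this, Ext.comp_mk₀_id]

/-- The short complex `R ⧸ I → R ⧸ I → R ⧸ (I + (r))`, with first map multiplication by `r`. -/
abbrev quotientSupSpanShortComplex (I : Ideal R) (r : R) : ShortComplex (ModuleCat.{u} R) :=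
  ModuleCat.shortComplexOfCompEqZero (r • (LinearMap.id : (R ⧸ I) →ₗ[R] R ⧸ I))
    (Submodule.factor (le_sup_left : I ≤ I ⊔ Ideal.span {r})) (by
      ext
      refine (Ideal.Quotient.eq_zero_iff_mem (I := I ⊔ Ideal.span {r})).2 ?_
      exact Ideal.mem_sup_right (by simp))

theorem shortExact_quotientSupSpanShortComplex {I : Ideal R} {r : R}
    (hr : ∀ a, r * a ∈ I → a ∈ I) : (quotientSupSpanShortComplex I r).ShortExact := by
  apply ModuleCat.shortComplex_shortExact
  · intro x
    obtain ⟨x, rfl⟩ := Ideal.Quotient.mk_surjective x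
    constructor
    · intro hx
      have hx : x ∈ I ⊔ Ideal.span {r} := Ideal.Quotient.eq_zero_iff_mem.1 hx
      obtain ⟨a, ha, b, hb, rfl⟩ := Submodule.mem_sup.1 hx
      obtain ⟨c, rfl⟩ := Ideal.mem_span_singleton'.1 hb
      refine ⟨Ideal.Quotient.mk I c, ?_⟩
      change Ideal.Quotient.mk I (r * c) = _
      rw [Ideal.Quotient.eq]
      simpa [mul_comm] using ha
    · rintro ⟨y, hy⟩
      obtain ⟨y, rfl⟩ := Ideal.Quotient.mk_surjective y
      have hy : Ideal.Quotient.mk I (r * y) = Ideal.Quotient.mk I x := hy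
      refine (Ideal.Quotient.eq_zero_iff_mem (I := I ⊔ Ideal.span {r})).2 ?_
      rw [Ideal.Quotient.eq, ← neg_mem_iff, neg_sub] at hy
      rw [← sub_add_cancel x (r * y)]
      exact add_mem (Ideal.mem_sup_left hy)
        (Ideal.mem_sup_right (Ideal.mul_mem_right _ _ (Ideal.mem_span_singleton_self r)))
  · rw [injective_iff_map_eq_zero]
    intro x hx
    obtain ⟨x, rfl⟩ := Ideal.Quotient.mk_surjective x
    exact Ideal.Quotient.eq_zero_iff_mem.2 (hr x (Ideal.Quotient.eq_zero_iff_mem.1 hx))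
  · exact Submodule.factor_surjective le_sup_left

theorem hasProjectiveDimensionLT_quotient_sup_span {I : Ideal R} {r : R} {n : ℕ}
    (hr : ∀ a, r * a ∈ I → a ∈ I) (h : HasProjectiveDimensionLT (ModuleCat.of R (R ⧸ I)) n) :
    HasProjectiveDimensionLT (ModuleCat.of R (R ⧸ (I ⊔ Ideal.span {r}))) (n + 1) :=
  (shortExact_quotientSupSpanShortComplex hr).hasProjectiveDimensionLT_X₃ n h
    (hasProjectiveDimensionLT_of_ge _ n (n + 1) (Nat.le_succ n))

/-- Mayer–Vietoris: `0 → R/(I ∩ J) → R/I × R/J → R/(I + J) → 0` is exact. The quotient by the sum is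
the right-hand term, so its dimension may be larger by one. -/
theorem hasProjectiveDimensionLT_quotient_inf {I J S : Ideal R} {n : ℕ} (hsup : I ⊔ J = S)
    (hI : HasProjectiveDimensionLT (ModuleCat.of R (R ⧸ I)) n)
    (hJ : HasProjectiveDimensionLT (ModuleCat.of R (R ⧸ J)) n)
    (h : HasProjectiveDimensionLT (ModuleCat.of R (R ⧸ S)) (n + 1)) :
    HasProjectiveDimensionLT (ModuleCat.of R (R ⧸ (I ⊓ J))) n := by
  subst hsup
  let f : (R ⧸ (I ⊓ J)) →ₗ[R] (R ⧸ I) × (R ⧸ J) :=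
    (Submodule.factor (inf_le_left : I ⊓ J ≤ I)).prod (Submodule.factor (inf_le_right : I ⊓ J ≤ J))
  let g : (R ⧸ I) × (R ⧸ J) →ₗ[R] (R ⧸ (I ⊔ J)) :=
    (Submodule.factor (le_sup_left : I ≤ I ⊔ J)).coprod
      (-Submodule.factor (le_sup_right : J ≤ I ⊔ J))
  have hg : ∀ a b : R, g (Ideal.Quotient.mk I a, Ideal.Quotient.mk J b) =
      Ideal.Quotient.mk (I ⊔ J) (a - b) := fun a b => by
    rw [map_sub, sub_eq_add_neg]; rfl
  have hf : ∀ a : R, f (Ideal.Quotient.mk (I ⊓ J) a) =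
      (Ideal.Quotient.mk I a, Ideal.Quotient.mk J a) := fun a => rfl
  have hS : (ModuleCat.shortComplexOfCompEqZero f g (by
      ext
      exact (hg 1 1).trans (by simp))).ShortExact := by
    apply ModuleCat.shortComplex_shortExact
    · rintro ⟨a, b⟩
      obtain ⟨a, rfl⟩ := Ideal.Quotient.mk_surjective a
      obtain ⟨b, rfl⟩ := Ideal.Quotient.mk_surjective b
      constructor
      · intro h
        have h : a - b ∈ I ⊔ J := Ideal.Quotient.eq_zero_iff_mem.1 ((hg a b).symm.trans h)
        obtain ⟨c, hc, d, hd, hcd⟩ := Submodule.mem_sup.1 h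
        refine ⟨Ideal.Quotient.mk _ (a - c), (hf _).trans ?_⟩
        rw [Prod.mk.injEq, Ideal.Quotient.eq, Ideal.Quotient.eq]
        refine ⟨by simpa using hc, ?_⟩
        rwa [show a - c - b = d by linear_combination - hcd]
      · rintro ⟨c, hc⟩
        obtain ⟨c, rfl⟩ := Ideal.Quotient.mk_surjective c
        have hc := (hf c).symm.trans hc
        rw [← hc]
        exact (hg c c).trans (by simp)
    · rw [injective_iff_map_eq_zero]
      intro x hx
      obtain ⟨x, rfl⟩ := Ideal.Quotient.mk_surjective x
      have hx : (Ideal.Quotient.mk I x, Ideal.Quotient.mk J x) = 0 := (hf x).symm.trans hx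
      rw [Prod.mk_eq_zero, Ideal.Quotient.eq_zero_iff_mem, Ideal.Quotient.eq_zero_iff_mem] at hx
      exact Ideal.Quotient.eq_zero_iff_mem.2 hx
    · intro x
      obtain ⟨x, rfl⟩ := Ideal.Quotient.mk_surjective x
      exact ⟨(Ideal.Quotient.mk I x, Ideal.Quotient.mk J 0), (hg x 0).trans (by simp)⟩
  have hprod : HasProjectiveDimensionLT (ModuleCat.of R ((R ⧸ I) × (R ⧸ J))) n := by
    have hS' : (ModuleCat.shortComplexOfCompEqZero (LinearMap.inl R (R ⧸ I) (R ⧸ J))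
        (LinearMap.snd R (R ⧸ I) (R ⧸ J)) (by ext; simp)).ShortExact :=
      ModuleCat.shortComplex_shortExact _ Function.Exact.inl_snd LinearMap.inl_injective
        LinearMap.snd_surjective
    exact hS'.hasProjectiveDimensionLT_X₂ n hI hJ
  exact hS.hasProjectiveDimensionLT_X₁ n hprod h

/-- Multiplication by `r` on `R/I` induces zero on Ext into `N`, since `r` kills `N`. The long exact
sequence therefore breaks into short exact ones, which give the sum in degree `i + 1`. The second
conjunct is the start of the sequence, in degree `0`. -/
theorem length_ext_quotient_sup_span {I : Ideal R} {r : R} (hr : ∀ a, r * a ∈ I → a ∈ I)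
    {N : ModuleCat.{u} R} (hN : ∀ n : N, r • n = 0) (i : ℕ) :
    Module.length R (Ext (ModuleCat.of R (R ⧸ I)) N i) +
        Module.length R (Ext (ModuleCat.of R (R ⧸ I)) N (i + 1)) ≤
      Module.length R (Ext (ModuleCat.of R (R ⧸ (I ⊔ Ideal.span {r}))) N (i + 1)) ∧
    Module.length R (Ext (ModuleCat.of R (R ⧸ I)) N 0) ≤
      Module.length R (Ext (ModuleCat.of R (R ⧸ (I ⊔ Ideal.span {r}))) N 0) := by
  have hS := shortExact_quotientSupSpanShortComplex hr
  have hf : (quotientSupSpanShortComplex I r).f = r • 𝟙 _ := rfl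
  have hzero : ∀ j (x : Ext (ModuleCat.of R (R ⧸ I)) N j),
      (Ext.mk₀ (quotientSupSpanShortComplex I r).f).comp x (zero_add j) = 0 := fun j x => by
    rw [hf, Ext.mk₀_smul, Ext.smul_comp]
    exact ModuleCat.ext_smul_eq_zero hN _
  have hsurj : ∀ j, Function.Surjective
      (Ext.precompOfLinear (Ext.mk₀ (quotientSupSpanShortComplex I r).g) R N (zero_add j)) :=
    fun j x => Ext.contravariant_sequence_exact₂ hS N x (hzero j x)
  refine ⟨?_, Module.length_le_of_surjective _ (hsurj 0)⟩
  refine (Module.length_eq_add_of_exact (Ext.precompOfLinear hS.extClass R N (add_comm 1 i)) _ ?_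
    (hsurj (i + 1)) ?_).ge
  · rw [injective_iff_map_eq_zero]
    intro x hx
    obtain ⟨y, rfl⟩ := Ext.contravariant_sequence_exact₁ hS N x (add_comm 1 i) hx
    exact hzero _ _
  · intro x
    constructor
    · intro hx
      exact Ext.contravariant_sequence_exact₃ hS N x hx (add_comm 1 i)
    · rintro ⟨y, rfl⟩
      exact hS.comp_extClass_assoc y (add_comm 1 i)

/-- If `f` multiplies `P` into `J` and acts as the identity on `N`, then `Ext(R ⧸ P, N)` embeds
into `Ext(R ⧸ J, N)`. -/
theorem length_ext_quotient_le_of_mul_mem {J P : Ideal R} (hJP : J ≤ P) {f : R}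
    (hf : ∀ p ∈ P, f * p ∈ J) {N : ModuleCat.{u} R} (hN : ∀ n : N, f • n = n) (i : ℕ) :
    Module.length R (Ext (ModuleCat.of R (R ⧸ P)) N i) ≤
      Module.length R (Ext (ModuleCat.of R (R ⧸ J)) N i) := by
  let π : ModuleCat.of R (R ⧸ J) ⟶ ModuleCat.of R (R ⧸ P) :=
    ModuleCat.ofHom (Submodule.factor hJP)
  let μ : ModuleCat.of R (R ⧸ P) ⟶ ModuleCat.of R (R ⧸ J) :=
    ModuleCat.ofHom (Submodule.liftQ P (f • Submodule.mkQ J) fun p hp => by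
      exact Ideal.Quotient.eq_zero_iff_mem.2 (hf p hp))
  -- On Ext into `N` this composite induces multiplication by `f`, which is the identity. So the map
  -- induced by `π` has a left inverse.
  have hμ : μ ≫ π = f • 𝟙 _ := by
    refine ModuleCat.hom_ext (LinearMap.ext fun x => ?_)
    obtain ⟨x, rfl⟩ := Ideal.Quotient.mk_surjective x
    rfl
  refine Module.length_le_of_injective (Ext.precompOfLinear (Ext.mk₀ π) R N (zero_add i)) ?_
  rw [injective_iff_map_eq_zero]
  intro x hx
  have hx : (Ext.mk₀ π).comp x (zero_add i) = 0 := hx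
  have h := Ext.mk₀_comp_mk₀_assoc μ π x
  rw [hx, Ext.comp_zero, hμ, Ext.mk₀_smul, Ext.smul_comp, Ext.mk₀_id_comp,
    ModuleCat.ext_smul_eq_self hN] at h
  exact h.symm

end ExtLength

/-! ### Ideals generated by variables, and by variables together with `X s * X t` -/

section VariableIdeals

open CategoryTheory Abelian

universe u

variable {K : Type u} [Field K] {σ : Type}

theorem MvPolynomial.X_mul_mem_span_X_image {T : Set σ} {k : σ} (hk : k ∉ T)
    (a : MvPolynomial σ K) (h : X k * a ∈ Ideal.span (X '' T)) :
    a ∈ Ideal.span (X '' T : Set (MvPolynomial σ K)) := by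
  classical
  rw [mem_ideal_span_X_image] at h ⊢
  intro m hm
  obtain ⟨i, hi, hi'⟩ := h (Finsupp.single k 1 + m) (by
    rw [mem_support_iff] at hm ⊢
    rwa [coeff_X_mul])
  refine ⟨i, hi, ?_⟩
  have : k ≠ i := fun h => hk (h ▸ hi)
  simpa [Finsupp.single_apply, this] using hi'

theorem MvPolynomial.span_X_image_insert [DecidableEq σ] (k : σ) (T : Finset σ) :
    (Ideal.span (X '' ((insert k T : Finset σ) : Set σ)) : Ideal (MvPolynomial σ K)) =
      Ideal.span (X '' (T : Set σ)) ⊔ Ideal.span {X k} := by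
  rw [Finset.coe_insert, Set.image_insert_eq, Ideal.span_insert, sup_comm]

theorem MvPolynomial.hasProjectiveDimensionLT_quotient_span_X (T : Finset σ) :
    HasProjectiveDimensionLT (ModuleCat.of (MvPolynomial σ K)
      (MvPolynomial σ K ⧸ Ideal.span (X '' (T : Set σ) : Set (MvPolynomial σ K)))) (T.card + 1) := by
  classical
  induction T using Finset.induction_on with
  | empty =>
    have : Module.Projective (MvPolynomial σ K)
        (MvPolynomial σ K ⧸ Ideal.span (X '' ((∅ : Finset σ) : Set σ) : Set (MvPolynomial σ K))) :=
      Module.Projective.of_equiv (Submodule.quotEquivOfEqBot _ (by simp)).symm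
    exact (projective_iff_hasProjectiveDimensionLT_one (X := ModuleCat.of _ _)).1
      ((IsProjective.iff_projective _).1 this)
  | insert k T hk ih =>
    rw [span_X_image_insert, Finset.card_insert_of_notMem hk]
    exact hasProjectiveDimensionLT_quotient_sup_span (X_mul_mem_span_X_image (by simpa using hk)) ih

theorem MvPolynomial.hasProjectiveDimensionLT_quotient_span_X_of_lt (T : Finset σ) {n : ℕ}
    (hn : T.card < n) :
    HasProjectiveDimensionLT (ModuleCat.of (MvPolynomial σ K)
      (MvPolynomial σ K ⧸ Ideal.span (X '' (T : Set σ) : Set (MvPolynomial σ K)))) n :=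
  have := hasProjectiveDimensionLT_quotient_span_X (K := K) T
  hasProjectiveDimensionLT_of_ge _ (T.card + 1) n hn

theorem MvPolynomial.hasProjectiveDimensionLT_quotient_span_X_sup (T : Finset σ) {s t : σ}
    (hs : s ∉ T) (ht : t ∉ T) {n : ℕ} (hn : T.card < n) :
    HasProjectiveDimensionLT (ModuleCat.of (MvPolynomial σ K)
      (MvPolynomial σ K ⧸ (Ideal.span (X '' (T : Set σ) : Set (MvPolynomial σ K)) ⊔
        Ideal.span {X s * X t}))) (n + 1) :=
  hasProjectiveDimensionLT_quotient_sup_span (fun a ha =>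
    X_mul_mem_span_X_image (by simpa using ht) a
      (X_mul_mem_span_X_image (by simpa using hs) _ (by rwa [← mul_assoc])))
    (hasProjectiveDimensionLT_quotient_span_X_of_lt T hn)

/-- Since `T ⊆ T'`, the two intersected ideals have sum `(T') + (X s * X t)`, again generated by a
regular sequence, so Mayer–Vietoris applies. -/
theorem MvPolynomial.hasProjectiveDimensionLT_quotient_span_X_sup_inf {T T' : Finset σ} {s t : σ}
    (hs : s ∉ T') (ht : t ∉ T') (hT : T ⊆ T') {n : ℕ} (hn : T'.card < n) :
    HasProjectiveDimensionLT (ModuleCat.of (MvPolynomial σ K)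
      (MvPolynomial σ K ⧸ ((Ideal.span (X '' (T : Set σ)) ⊔ Ideal.span {X s * X t}) ⊓
        Ideal.span (X '' (T' : Set σ)) : Ideal (MvPolynomial σ K)))) (n + 1) := by
  have hle : Ideal.span (X '' (T : Set σ) : Set (MvPolynomial σ K)) ≤
      Ideal.span (X '' (T' : Set σ)) := Ideal.span_mono (Set.image_mono hT)
  refine hasProjectiveDimensionLT_quotient_inf
    (S := Ideal.span (X '' (T' : Set σ)) ⊔ Ideal.span {X s * X t})
    (by rw [sup_right_comm, sup_eq_right.2 hle])
    (hasProjectiveDimensionLT_quotient_span_X_sup T (fun h => hs (hT h)) (fun h => ht (hT h))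
      ((Finset.card_le_card hT).trans_lt hn))
    (hasProjectiveDimensionLT_quotient_span_X_of_lt T' (Nat.lt_succ_of_lt hn))
    (hasProjectiveDimensionLT_quotient_span_X_sup T' hs ht (Nat.lt_succ_of_lt hn))

/-- Adjoining one variable adds the lengths in degrees `i` and `i + 1`, which is Pascal's rule. The
simple module need not be supported at the origin; it only has to be killed by the variables in `T`.
-/
theorem MvPolynomial.choose_le_length_ext_quotient_span_X (T : Finset σ)
    (N : ModuleCat.{u} (MvPolynomial σ K)) [IsSimpleModule (MvPolynomial σ K) N]
    (hN : ∀ k ∈ T, ∀ n : N, (X k : MvPolynomial σ K) • n = 0) (i : ℕ) :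
    (T.card.choose i : ℕ∞) ≤ Module.length (MvPolynomial σ K)
      (Ext (ModuleCat.of (MvPolynomial σ K)
        (MvPolynomial σ K ⧸ Ideal.span (X '' (T : Set σ) : Set (MvPolynomial σ K)))) N i) := by
  classical
  induction T using Finset.induction_on generalizing i with
  | empty =>
    obtain _ | i := i
    · let e := (Submodule.quotEquivOfEqBot
        (Ideal.span (X '' ((∅ : Finset σ) : Set σ) : Set (MvPolynomial σ K))) (by simp))
      rw [(ModuleCat.extZeroLinearEquiv _ N).length_eq,
        ((e.congrLeft N (MvPolynomial σ K)).trans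
          (LinearMap.ringLmapEquivSelf (MvPolynomial σ K) (MvPolynomial σ K) N)).length_eq,
        Module.length_eq_one]
      simp
    · simp
  | insert k T hk ih =>
    have ih := ih fun k hk => hN k (Finset.mem_insert_of_mem hk)
    have h := fun i => length_ext_quotient_sup_span
      (X_mul_mem_span_X_image (K := K) (T := T) (k := k) (by simpa using hk))
      (hN k (Finset.mem_insert_self k T)) i
    rw [span_X_image_insert, Finset.card_insert_of_notMem hk]
    obtain _ | i := i
    · simpa using (ih 0).trans (h 0).2
    · rw [Nat.choose_succ_succ, Nat.cast_add]
      exact (add_le_add (ih i) (ih (i + 1))).trans (h i).1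

theorem MvPolynomial.mem_span_X_image_sup_iff {T : Set σ} {s t : σ} (hst : s ≠ t)
    {f : MvPolynomial σ K} :
    f ∈ (Ideal.span (X '' T) ⊔ Ideal.span {X s * X t} : Ideal (MvPolynomial σ K)) ↔
      ∀ m ∈ f.support, (∃ k ∈ T, m k ≠ 0) ∨ (m s ≠ 0 ∧ m t ≠ 0) := by
  classical
  have h : (Ideal.span (X '' T) ⊔ Ideal.span {X s * X t} : Ideal (MvPolynomial σ K)) =
      Ideal.span ((fun m => monomial m (1 : K)) ''
        ((fun k => Finsupp.single k 1) '' T ∪ {Finsupp.single s 1 + Finsupp.single t 1})) := by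
    rw [Set.image_union, Ideal.span_union, Set.image_image, Set.image_singleton]
    simp only [X, monomial_mul, one_mul]
    rfl
  rw [h, mem_ideal_span_monomial_image]
  refine forall₂_congr fun m _ => ?_
  have h1 : ∀ k, Finsupp.single k 1 ≤ m ↔ m k ≠ 0 := fun k => by
    simp [Finsupp.single_le_iff, Nat.one_le_iff_ne_zero]
  have h2 : Finsupp.single s 1 + Finsupp.single t 1 ≤ m ↔ m s ≠ 0 ∧ m t ≠ 0 := by
    rw [← h1, ← h1]
    constructor
    · exact fun h => ⟨le_trans le_self_add h, le_trans le_add_self h⟩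
    · rintro ⟨hs, ht⟩ k
      have hs := hs k
      have ht := ht k
      simp only [Finsupp.add_apply, Finsupp.single_apply] at hs ht ⊢
      split_ifs at * <;> first | omega | (subst_vars; exact absurd rfl hst)
  simp [or_and_right, exists_or, h1, h2, or_comm]

end VariableIdeals

/-! ### Normal forms of monomials modulo the join-meet ideal -/

namespace CrystalLattice

variable {n₁ n₂ : ℕ}

theorem crystalMonomialOrder_lt_iff {a b : CrystalLattice n₁ n₂ →₀ ℕ} :
    (crystalMonomialOrder n₁ n₂).toSyn a < (crystalMonomialOrder n₁ n₂).toSyn b ↔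
      a.degree < b.degree ∨ (a.degree = b.degree ∧
        ∃ i, (∀ j, position j < position i → a j = b j) ∧ b i < a i) :=
  @DegRevLex.equiv_lt_iff _ (variableOrder n₁ n₂) _ a b

theorem finsupp_eq_sum (m : CrystalLattice n₁ n₂ →₀ ℕ) :
    m = Finsupp.single s (m s) + Finsupp.single t (m t) +
      ∑ p, Finsupp.single (x p) (m (x p)) + ∑ q, Finsupp.single (y q) (m (y q)) := by
  classical
  ext a
  cases a <;> simp [Finsupp.single_apply]

theorem degree_eq (m : CrystalLattice n₁ n₂ →₀ ℕ) :
    m.degree = m s + m t + ∑ p, m (x p) + ∑ q, m (y q) := by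
  conv_lhs => rw [finsupp_eq_sum m]
  simp

variable [NeZero n₁] [NeZero n₂]

/-- The exponent of the standard monomial congruent to the monomial with exponent `m` modulo the
join-meet ideal. -/
def normalForm (m : CrystalLattice n₁ n₂ →₀ ℕ) : CrystalLattice n₁ n₂ →₀ ℕ :=
  -- Each pair `x_p y_q` is traded for `s t`, as often as possible. Once `s t` divides the monomial,
  -- all remaining chain variables can be moved to the first of their chain. If neither applies, no
  -- relation changes the monomial.
  if (m s ≠ 0 ∧ m t ≠ 0) ∨ min (∑ p, m (x p)) (∑ q, m (y q)) ≠ 0 then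
    Finsupp.single s (m s + min (∑ p, m (x p)) (∑ q, m (y q))) +
      Finsupp.single t (m t + min (∑ p, m (x p)) (∑ q, m (y q))) +
      Finsupp.single (x 0) (∑ p, m (x p) - min (∑ p, m (x p)) (∑ q, m (y q))) +
      Finsupp.single (y 0) (∑ q, m (y q) - min (∑ p, m (x p)) (∑ q, m (y q)))
  else m

/-- The exponents of the monomials in the initial ideal. -/
def IsInitialExponent (m : CrystalLattice n₁ n₂ →₀ ℕ) : Prop :=
  (∃ p q, m (x p) ≠ 0 ∧ m (y q) ≠ 0) ∨
    (m s ≠ 0 ∧ m t ≠ 0 ∧ ((∃ p, p ≠ 0 ∧ m (x p) ≠ 0) ∨ ∃ q, q ≠ 0 ∧ m (y q) ≠ 0))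

/-- A factor `x_p y_q` raises both chain sums, hence their minimum, by one. A factor `s t` raises
the exponents of `s` and `t` instead. The normal form sees only the total in each case. -/
theorem normalForm_add_single_x_add_single_y (m : CrystalLattice n₁ n₂ →₀ ℕ) (p : Fin n₁)
    (q : Fin n₂) :
    normalForm (m + (Finsupp.single (x p) 1 + Finsupp.single (y q) 1)) =
      normalForm (m + (Finsupp.single s 1 + Finsupp.single t 1)) := by
  classical
  have hx : ∑ p', (m + (Finsupp.single (x p) 1 + Finsupp.single (y q) 1) : CrystalLattice n₁ n₂ →₀ ℕ) (x p') =
      ∑ p', m (x p') + 1 := by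
    simp [Finsupp.single_apply, Finset.sum_add_distrib]
  have hy : ∑ q', (m + (Finsupp.single (x p) 1 + Finsupp.single (y q) 1) : CrystalLattice n₁ n₂ →₀ ℕ) (y q') =
      ∑ q', m (y q') + 1 := by
    simp [Finsupp.single_apply, Finset.sum_add_distrib]
  have hx' : ∑ p', (m + (Finsupp.single s 1 + Finsupp.single t 1) : CrystalLattice n₁ n₂ →₀ ℕ) (x p') =
      ∑ p', m (x p') := by
    simp
  have hy' : ∑ q', (m + (Finsupp.single s 1 + Finsupp.single t 1) : CrystalLattice n₁ n₂ →₀ ℕ) (y q') =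
      ∑ q', m (y q') := by
    simp
  have hs : (m + (Finsupp.single (x p) 1 + Finsupp.single (y q) 1) : CrystalLattice n₁ n₂ →₀ ℕ) s
      = m s := by
    simp
  have ht : (m + (Finsupp.single (x p) 1 + Finsupp.single (y q) 1) : CrystalLattice n₁ n₂ →₀ ℕ) t
      = m t := by
    simp
  have hs' : (m + (Finsupp.single s 1 + Finsupp.single t 1) : CrystalLattice n₁ n₂ →₀ ℕ) s
      = m s + 1 := by
    simp
  have ht' : (m + (Finsupp.single s 1 + Finsupp.single t 1) : CrystalLattice n₁ n₂ →₀ ℕ) t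
      = m t + 1 := by
    simp
  unfold normalForm
  rw [hx, hy, hx', hy', hs, ht, hs', ht', if_pos (Or.inr (by omega)),
    if_pos (Or.inl ⟨by omega, by omega⟩), Nat.add_min_add_right, Nat.add_sub_add_right,
    Nat.add_sub_add_right, add_right_comm (m s) 1, add_right_comm (m t) 1, add_assoc (m s),
    add_assoc (m t)]

theorem normalForm_add_single_add_single (m : CrystalLattice n₁ n₂ →₀ ℕ)
    (a b : CrystalLattice n₁ n₂) :
    normalForm (m + (Finsupp.single a 1 + Finsupp.single b 1)) =
      normalForm (m + (Finsupp.single (a ⊔ b) 1 + Finsupp.single (a ⊓ b) 1)) := by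
  by_cases hab : a ≤ b
  · rw [sup_eq_right.2 hab, inf_eq_left.2 hab, add_comm (Finsupp.single a 1)]
  by_cases hba : b ≤ a
  · rw [sup_eq_left.2 hba, inf_eq_right.2 hba]
  cases a with
  | s => exact absurd trivial hab
  | t => exact absurd (by cases b <;> trivial) hba
  | x p =>
    cases b with
    | s => exact absurd trivial hba
    | t => exact absurd trivial hab
    | x p' => exact absurd ((le_total p p').resolve_left hab) hba
    | y q =>
      rw [normalForm_add_single_x_add_single_y, add_comm (Finsupp.single s 1)]
      rfl
  | y q =>
    cases b with
    | s => exact absurd trivial hba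
    | t => exact absurd trivial hab
    | y q' => exact absurd ((le_total q q').resolve_left hab) hba
    | x p =>
      rw [add_comm (Finsupp.single (y q) 1), normalForm_add_single_x_add_single_y,
        add_comm (Finsupp.single s 1)]
      rfl

theorem normalForm_eq_self {m : CrystalLattice n₁ n₂ →₀ ℕ} (hm : ¬ IsInitialExponent m) :
    normalForm m = m := by
  classical
  have hxy : (∀ p, m (x p) = 0) ∨ ∀ q, m (y q) = 0 := by
    by_contra! h
    obtain ⟨⟨p, hp⟩, q, hq⟩ := h
    exact hm (Or.inl ⟨p, q, hp, hq⟩)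
  have hmin : min (∑ p, m (x p)) (∑ q, m (y q)) = 0 := by
    rcases hxy with h | h <;> simp [h]
  unfold normalForm
  split_ifs with h
  · obtain ⟨hs, ht⟩ := h.resolve_right (by simp [hmin])
    rw [hmin]
    have hx : ∀ p, p ≠ 0 → m (x p) = 0 := fun p hp => by
      by_contra h
      exact hm (Or.inr ⟨hs, ht, Or.inl ⟨p, hp, h⟩⟩)
    have hy : ∀ q, q ≠ 0 → m (y q) = 0 := fun q hq => by
      by_contra h
      exact hm (Or.inr ⟨hs, ht, Or.inr ⟨q, hq, h⟩⟩)
    rw [Finset.sum_eq_single_of_mem 0 (Finset.mem_univ _) fun p _ => hx p,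
      Finset.sum_eq_single_of_mem 0 (Finset.mem_univ _) fun q _ => hy q]
    ext a
    cases a with
    | s => simp
    | t => simp
    | x p =>
      by_cases hp : p = 0
      · simp [hp]
      · simp [hx p hp, Ne.symm hp]
    | y q =>
      by_cases hq : q = 0
      · simp [hq]
      · simp [hy q hq, Ne.symm hq]
  · rfl

theorem degree_normalForm (m : CrystalLattice n₁ n₂ →₀ ℕ) :
    (normalForm m).degree = m.degree := by
  unfold normalForm
  split_ifs with h
  · rw [degree_eq m]
    simp only [map_add, Finsupp.degree_single]
    omega
  · rfl

/-- Either all exponents of `f` but the first vanish, or the first falls short of the total. -/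
theorem sum_eq_apply_zero_or_lt {n : ℕ} [NeZero n] (f : Fin n → ℕ) :
    (∀ p, p ≠ 0 → f p = 0) ∨ f 0 < ∑ p, f p := by
  by_cases h : ∀ p, p ≠ 0 → f p = 0
  · exact Or.inl h
  · push Not at h
    obtain ⟨p, hp, hfp⟩ := h
    exact Or.inr (Finset.single_lt_sum hp (Finset.mem_univ _) (Finset.mem_univ _)
      (Nat.pos_of_ne_zero hfp) fun _ _ _ => Nat.zero_le _)

theorem normalForm_le (m : CrystalLattice n₁ n₂ →₀ ℕ) :
    (crystalMonomialOrder n₁ n₂).toSyn (normalForm m) ≤ (crystalMonomialOrder n₁ n₂).toSyn m := by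
  classical
  by_cases h : (m s ≠ 0 ∧ m t ≠ 0) ∨ min (∑ p, m (x p)) (∑ q, m (y q)) ≠ 0
  swap
  · rw [normalForm, if_neg h]
  by_cases heq : normalForm m = m
  · rw [heq]
  refine le_of_lt (crystalMonomialOrder_lt_iff.2 (Or.inr ⟨degree_normalForm m, ?_⟩))
  by_cases hmin : min (∑ p, m (x p)) (∑ q, m (y q)) = 0
  swap
  -- Trading a pair raises the exponent of `s`, the smallest variable, and this makes the monomial
  -- smaller.
  · refine ⟨s, fun j hj => absurd hj (Nat.not_lt_zero _), ?_⟩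
    rw [normalForm, if_pos h]
    simp
    omega
  have hs : normalForm m s = m s := by
    rw [normalForm, if_pos h, hmin]; simp
  have ht : normalForm m t = m t := by
    rw [normalForm, if_pos h, hmin]; simp
  have hx : ∀ p, normalForm m (x p) = if p = 0 then ∑ p, m (x p) else 0 := fun p => by
    rw [normalForm, if_pos h, hmin]; simp [Finsupp.single_apply, eq_comm]
  have hy : ∀ q, normalForm m (y q) = if q = 0 then ∑ q, m (y q) else 0 := fun q => by
    rw [normalForm, if_pos h, hmin]; simp [Finsupp.single_apply, eq_comm]
  -- With no pair to trade, `s` and `t` keep their exponents. The first change is then a gain at `x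
  -- 0` or, if the first chain is unaffected, at `y 0`.
  rcases sum_eq_apply_zero_or_lt (fun p => m (x p)) with h1 | h1
  · have hx' : ∀ p, normalForm m (x p) = m (x p) := fun p => by
      rw [hx]
      split_ifs with hp
      · rw [hp, Finset.sum_eq_single_of_mem 0 (Finset.mem_univ _) fun p _ => h1 p]
      · exact (h1 p hp).symm
    rcases sum_eq_apply_zero_or_lt (fun q => m (y q)) with h2 | h2
    · refine absurd (Finsupp.ext fun a => ?_) heq
      cases a with
      | s => exact hs
      | t => exact ht
      | x p => exact hx' p
      | y q =>
        rw [hy]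
        split_ifs with hq
        · rw [hq, Finset.sum_eq_single_of_mem 0 (Finset.mem_univ _) fun q _ => h2 q]
        · exact (h2 q hq).symm
    · refine ⟨y 0, fun j hj => ?_, by simpa [hy] using h2⟩
      cases j with
      | s => exact hs
      | t => exact ht
      | x p => exact hx' p
      | y q => simp [position, Fin.lt_def] at hj
  · refine ⟨x 0, fun j hj => ?_, by simpa [hx] using h1⟩
    cases j with
    | s => exact hs
    | t => exact ht
    | x p => simp [position, Fin.lt_def] at hj
    | y q => simp [position, Fin.lt_def] at hj

end CrystalLattice

open CrystalLattice

/-! ### The monomial generators of the initial ideal -/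

section InitialIdeal

universe u

variable {K : Type u} [Field K] {n₁ n₂ : ℕ} [NeZero n₁] [NeZero n₂]

/-- The linear map replacing every monomial by its normal form. -/
def reduceToNormalForm (K : Type u) [Field K] (n₁ n₂ : ℕ) [NeZero n₁] [NeZero n₂] :
    MvPolynomial (CrystalLattice n₁ n₂) K →ₗ[K] MvPolynomial (CrystalLattice n₁ n₂) K :=
  (basisMonomials _ K).constr K fun m => monomial (normalForm m) 1

theorem reduceToNormalForm_monomial (m : CrystalLattice n₁ n₂ →₀ ℕ) (c : K) :
    reduceToNormalForm K n₁ n₂ (monomial m c) = monomial (normalForm m) c := by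
  have h : (monomial m c : MvPolynomial (CrystalLattice n₁ n₂) K) =
      c • basisMonomials _ K m := by simp [smul_monomial]
  rw [h, map_smul, reduceToNormalForm, Module.Basis.constr_basis, smul_monomial, smul_eq_mul,
    mul_one]

theorem reduceToNormalForm_eq_zero {f : MvPolynomial (CrystalLattice n₁ n₂) K}
    (hf : f ∈ joinMeetIdeal K (CrystalLattice n₁ n₂)) : reduceToNormalForm K n₁ n₂ f = 0 := by
  -- The reduction is only `K`-linear, so the induction over the span has to carry all multiples.
  suffices ∀ g, reduceToNormalForm K n₁ n₂ (g * f) = 0 by simpa using this 1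
  refine Submodule.span_induction (p := fun f _ => ∀ g, reduceToNormalForm K n₁ n₂ (g * f) = 0)
    ?_ ?_ ?_ ?_ hf
  · rintro _ ⟨a, b, rfl⟩ g
    induction g using MvPolynomial.induction_on' with
    | monomial m c =>
      rw [mul_sub, X, X, X, X, monomial_mul, monomial_mul, monomial_mul, monomial_mul, map_sub,
        reduceToNormalForm_monomial, reduceToNormalForm_monomial,
        normalForm_add_single_add_single, sub_eq_zero]
    | add g h hg hh => rw [add_mul, map_add, hg, hh, add_zero]
  · simp
  · intro f g _ _ hf hg h
    rw [mul_add, map_add, hf, hg, add_zero]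
  · intro a f _ hf g
    rw [smul_eq_mul, ← mul_assoc]
    exact hf _

/-- A standard leading exponent would be its own normal form. As the reduction kills `f`, its
coefficient must cancel against another exponent of `f` with the same normal form. That exponent is
at least its normal form, hence at least the leading one, which is impossible. -/
theorem isInitialExponent_degree {f : MvPolynomial (CrystalLattice n₁ n₂) K}
    (hf : f ∈ joinMeetIdeal K (CrystalLattice n₁ n₂)) (hf0 : f ≠ 0) :
    IsInitialExponent ((crystalMonomialOrder n₁ n₂).degree f) := by
  classical
  by_contra hm
  set m₀ := (crystalMonomialOrder n₁ n₂).degree f with hm₀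
  have hmem : m₀ ∈ f.support := (crystalMonomialOrder n₁ n₂).degree_mem_support hf0
  have hsum : ∑ m ∈ f.support, (if normalForm m = m₀ then coeff m f else 0) = 0 := by
    have h := congrArg (coeff m₀) (reduceToNormalForm_eq_zero hf)
    rw [f.as_sum, map_sum, coeff_sum] at h
    simpa only [reduceToNormalForm_monomial, coeff_monomial, coeff_zero] using h
  obtain ⟨m, hmf, hne, hmm⟩ : ∃ m ∈ f.support, m ≠ m₀ ∧ normalForm m = m₀ := by
    by_contra! h
    rw [Finset.sum_eq_single_of_mem m₀ hmem fun m hm hne => if_neg (h m hm hne),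
      if_pos (normalForm_eq_self hm)] at hsum
    exact mem_support_iff.1 hmem hsum
  refine hne ((crystalMonomialOrder n₁ n₂).toSyn.injective (le_antisymm ?_ ?_))
  · exact (crystalMonomialOrder n₁ n₂).le_degree hmf
  · rw [← hmm]
    exact normalForm_le m

theorem isUpperSet_isInitialExponent :
    IsUpperSet {m : CrystalLattice n₁ n₂ →₀ ℕ | IsInitialExponent m} := by
  intro m m' hmm h
  have hne : ∀ a, m a ≠ 0 → m' a ≠ 0 := fun a ha => by
    have := hmm a
    omega
  rcases h with ⟨p, q, hp, hq⟩ | ⟨hs, ht, ⟨p, hp, hp'⟩ | ⟨q, hq, hq'⟩⟩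
  · exact Or.inl ⟨p, q, hne _ hp, hne _ hq⟩
  · exact Or.inr ⟨hne _ hs, hne _ ht, Or.inl ⟨p, hp, hne _ hp'⟩⟩
  · exact Or.inr ⟨hne _ hs, hne _ ht, Or.inr ⟨q, hq, hne _ hq'⟩⟩

theorem monomial_mem_initialIdeal {σ : Type*} {o : MonomialOrder σ} {I : Ideal (MvPolynomial σ K)}
    {a b : σ →₀ ℕ} (h : (monomial a 1 - monomial b 1 : MvPolynomial σ K) ∈ I)
    (hlt : o.toSyn b < o.toSyn a) {m : σ →₀ ℕ} (hm : a ≤ m) (c : K) :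
    monomial m c ∈ initialIdeal o I := by
  classical
  have hdeg : o.toSyn (o.degree (monomial b 1 : MvPolynomial σ K)) <
      o.toSyn (o.degree (monomial a 1 : MvPolynomial σ K)) := by
    simpa [MonomialOrder.degree_monomial] using hlt
  have hlead : o.leadingTerm (monomial a 1 - monomial b 1 : MvPolynomial σ K) = monomial a 1 := by
    rw [MonomialOrder.leadingTerm, o.degree_sub_of_lt hdeg, o.leadingCoeff_sub_of_lt hdeg]
    simp [MonomialOrder.degree_monomial]
  have : (monomial m c : MvPolynomial σ K) = monomial (m - a) c * monomial a 1 := by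
    rw [monomial_mul, tsub_add_cancel_of_le hm, mul_one]
  rw [this]
  exact Ideal.mul_mem_left _ _ (Ideal.subset_span ⟨_, h, hlead⟩)

theorem Finsupp.single_add_single_le {σ : Type*} {a b : σ} (hab : a ≠ b) {m : σ →₀ ℕ}
    (ha : m a ≠ 0) (hb : m b ≠ 0) : Finsupp.single a 1 + Finsupp.single b 1 ≤ m := by
  classical
  intro k
  simp only [Finsupp.add_apply, Finsupp.single_apply]
  split_ifs <;> subst_vars <;> first | omega | exact absurd rfl hab

theorem Finsupp.single_add_single_add_single_le {σ : Type*} {a b c : σ} (hab : a ≠ b)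
    (hac : a ≠ c) (hbc : b ≠ c) {m : σ →₀ ℕ} (ha : m a ≠ 0) (hb : m b ≠ 0) (hc : m c ≠ 0) :
    Finsupp.single a 1 + Finsupp.single b 1 + Finsupp.single c 1 ≤ m := by
  classical
  intro k
  simp only [Finsupp.add_apply, Finsupp.single_apply]
  split_ifs <;> subst_vars <;>
    first | omega | exact absurd rfl hab | exact absurd rfl hac | exact absurd rfl hbc

omit [NeZero n₁] [NeZero n₂] in
theorem X_mul_X_sub_mem_joinMeetIdeal (p : Fin n₁) (q : Fin n₂) :
    (X (x p) * X (y q) - X t * X s : MvPolynomial (CrystalLattice n₁ n₂) K) ∈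
      joinMeetIdeal K (CrystalLattice n₁ n₂) :=
  Ideal.subset_span ⟨x p, y q, rfl⟩

/-- The initial ideal is the monomial ideal generated by all `x_p y_q`, and by all `s t x_p` and
`s t y_q` with `p`, `q` not the first index. -/
theorem mem_crystalInitialIdeal_iff {f : MvPolynomial (CrystalLattice n₁ n₂) K} :
    f ∈ crystalInitialIdeal K n₁ n₂ ↔ ∀ m ∈ f.support, IsInitialExponent m := by
  classical
  constructor
  · intro hf
    suffices h : crystalInitialIdeal K n₁ n₂ ≤
        restrictSupportIdeal K {m | IsInitialExponent m} isUpperSet_isInitialExponent from h hf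
    refine Ideal.span_le.2 ?_
    rintro _ ⟨g, hg, rfl⟩ m hm
    have hm : m ∈ ((crystalMonomialOrder n₁ n₂).leadingTerm g).support := hm
    rw [MonomialOrder.leadingTerm, support_monomial] at hm
    split_ifs at hm with h0
    · simp at hm
    · rw [Finset.mem_singleton] at hm
      rw [hm]
      exact isInitialExponent_degree hg (by simpa using h0)
  · intro hf
    rw [f.as_sum]
    refine sum_mem fun m hm => ?_
    rcases hf m hm with ⟨p, q, hp, hq⟩ | ⟨hs, ht, ⟨p, hp, hp'⟩ | ⟨q, hq, hq'⟩⟩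
    · refine monomial_mem_initialIdeal (a := Finsupp.single (x p) 1 + Finsupp.single (y q) 1)
        (b := Finsupp.single t 1 + Finsupp.single s 1) ?_ ?_
        (Finsupp.single_add_single_le (by simp) hp hq) _
      · simpa [X, monomial_mul] using X_mul_X_sub_mem_joinMeetIdeal (K := K) p q
      · refine crystalMonomialOrder_lt_iff.2 (Or.inr ⟨by simp, s,
          fun j hj => absurd hj (Nat.not_lt_zero _), ?_⟩)
        simp
    · refine monomial_mem_initialIdeal
        (a := Finsupp.single s 1 + Finsupp.single t 1 + Finsupp.single (x p) 1)
        (b := Finsupp.single s 1 + Finsupp.single t 1 + Finsupp.single (x 0) 1) ?_ ?_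
        (Finsupp.single_add_single_add_single_le (by simp) (by simp) (by simp) hs ht hp') _
      -- The S-polynomial `x_0 (x_p y_0 - t s) - x_p (x_0 y_0 - t s) = s t (x_p - x_0)`.
      · have h := sub_mem
          (Ideal.mul_mem_left _ (X (x 0)) (X_mul_X_sub_mem_joinMeetIdeal (K := K) p (0 : Fin n₂)))
          (Ideal.mul_mem_left _ (X (x p)) (X_mul_X_sub_mem_joinMeetIdeal (K := K) 0 (0 : Fin n₂)))
        convert h using 1
        rw [show ∀ a : CrystalLattice n₁ n₂,
          (monomial (Finsupp.single s 1 + Finsupp.single t 1 + Finsupp.single a 1) 1 :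
            MvPolynomial _ K) = X s * X t * X a from fun a => by simp [X, monomial_mul],
          show (monomial (Finsupp.single s 1 + Finsupp.single t 1 + Finsupp.single (x 0) 1) 1 :
            MvPolynomial (CrystalLattice n₁ n₂) K) = X s * X t * X (x 0) by
              simp [X, monomial_mul]]
        ring
      · refine crystalMonomialOrder_lt_iff.2 (Or.inr ⟨by simp, x 0, fun j hj => ?_, ?_⟩)
        · cases j <;> simp [position, Fin.lt_def] at hj ⊢
        · simp [hp]
    · refine monomial_mem_initialIdeal
        (a := Finsupp.single s 1 + Finsupp.single t 1 + Finsupp.single (y q) 1)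
        (b := Finsupp.single s 1 + Finsupp.single t 1 + Finsupp.single (y 0) 1) ?_ ?_
        (Finsupp.single_add_single_add_single_le (by simp) (by simp) (by simp) hs ht hq') _
      · have h := sub_mem
          (Ideal.mul_mem_left _ (X (y 0)) (X_mul_X_sub_mem_joinMeetIdeal (K := K) (0 : Fin n₁) q))
          (Ideal.mul_mem_left _ (X (y q)) (X_mul_X_sub_mem_joinMeetIdeal (K := K) (0 : Fin n₁) 0))
        convert h using 1
        rw [show ∀ a : CrystalLattice n₁ n₂,
          (monomial (Finsupp.single s 1 + Finsupp.single t 1 + Finsupp.single a 1) 1 :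
            MvPolynomial _ K) = X s * X t * X a from fun a => by simp [X, monomial_mul],
          show (monomial (Finsupp.single s 1 + Finsupp.single t 1 + Finsupp.single (y 0) 1) 1 :
            MvPolynomial (CrystalLattice n₁ n₂) K) = X s * X t * X (y 0) by
              simp [X, monomial_mul]]
        ring
      · refine crystalMonomialOrder_lt_iff.2 (Or.inr ⟨by simp, y 0, fun j hj => ?_, ?_⟩)
        · cases j <;> simp [position, Fin.lt_def] at hj ⊢
        · simp [hq]

end InitialIdeal

/-! ### Existence of minimal graded free resolutions -/

section GradedResolution

universe u

variable {K : Type u} [Field K] {σ : Type}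

/-- The part of degree `j` of a polynomial, viewed as an element of `R(-e)`. -/
def shiftedComponent (e j : ℕ) : MvPolynomial σ K →ₗ[K] MvPolynomial σ K :=
  -- The guard matters: truncated subtraction would otherwise return the constant term when `j < e`.
  if e ≤ j then homogeneousComponent (j - e) else 0

theorem coeff_shiftedComponent (e j : ℕ) (p : MvPolynomial σ K) (a : σ →₀ ℕ) :
    coeff a (shiftedComponent e j p) = if a.degree + e = j then coeff a p else 0 := by
  unfold shiftedComponent
  split_ifs with h1 h2 h2
  · rw [coeff_homogeneousComponent, if_pos (by omega)]
  · rw [coeff_homogeneousComponent, if_neg (by omega)]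
  · omega
  · simp

variable {r : ℕ} (δ : Fin r → ℕ)

/-- The part of degree `j` of an element of `⨁ c, R(-δ c)`. -/
def gradedComponent (j : ℕ) :
    (Fin r → MvPolynomial σ K) →ₗ[K] (Fin r → MvPolynomial σ K) :=
  LinearMap.pi fun c => (shiftedComponent (δ c) j).comp (LinearMap.proj c)

theorem gradedComponent_apply (j : ℕ) (v : Fin r → MvPolynomial σ K) (c : Fin r) :
    gradedComponent δ j v c = shiftedComponent (δ c) j (v c) := rfl

/-- The homogeneous elements of degree `j` of `⨁ c, R(-δ c)`. -/
def IsShiftedHomogeneous (j : ℕ) (v : Fin r → MvPolynomial σ K) : Prop :=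
  ∀ c, ∀ a ∈ (v c).support, a.degree + δ c = j

theorem isShiftedHomogeneous_gradedComponent (j : ℕ) (v : Fin r → MvPolynomial σ K) :
    IsShiftedHomogeneous δ j (gradedComponent δ j v) := by
  intro c a ha
  rw [mem_support_iff, gradedComponent_apply, coeff_shiftedComponent] at ha
  by_contra h
  exact ha (if_neg h)

theorem exists_eq_sum_gradedComponent (v : Fin r → MvPolynomial σ K) :
    ∃ N, v = ∑ j ∈ Finset.range N, gradedComponent δ j v := by
  refine ⟨(Finset.univ.sup fun c => (v c).totalDegree + δ c) + 1, ?_⟩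
  ext c a
  rw [Finset.sum_apply, coeff_sum]
  simp only [gradedComponent_apply, coeff_shiftedComponent, Finset.sum_ite_eq, Finset.mem_range]
  split_ifs with h
  · rfl
  · by_contra ha
    have h1 := le_totalDegree (mem_support_iff.2 ha)
    have h2 := Finset.le_sup (f := fun c => (v c).totalDegree + δ c) (Finset.mem_univ c)
    rw [Finsupp.sum, ← Finsupp.degree_apply] at h1
    omega

variable {δ}

theorem gradedComponent_smul {e : ℕ} {g : Fin r → MvPolynomial σ K}
    (hg : IsShiftedHomogeneous δ e g) (j : ℕ) (p : MvPolynomial σ K) :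
    gradedComponent δ j (p • g) = shiftedComponent e j p • g := by
  classical
  ext c a
  have h : ∀ b ∈ Finset.HasAntidiagonal.antidiagonal a, coeff b.1 (shiftedComponent e j p) * coeff b.2 (g c) =
      if a.degree + δ c = j then coeff b.1 p * coeff b.2 (g c) else 0 := by
    intro b hb
    rw [coeff_shiftedComponent]
    by_cases hb2 : coeff b.2 (g c) = 0
    · simp [hb2]
    · have h := hg c b.2 (mem_support_iff.2 hb2)
      rw [← Finset.HasAntidiagonal.mem_antidiagonal.1 hb, map_add, ite_mul, zero_mul]
      exact if_congr (by omega) rfl rfl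
  rw [gradedComponent_apply, coeff_shiftedComponent, Pi.smul_apply, Pi.smul_apply, smul_eq_mul,
    smul_eq_mul, coeff_mul, coeff_mul, Finset.sum_congr rfl h]
  split_ifs <;> simp

/-- A submodule of `⨁ c, R(-δ c)` is graded if it contains the components of its elements. -/
def IsGradedSubmodule (δ : Fin r → ℕ)
    (Ω : Submodule (MvPolynomial σ K) (Fin r → MvPolynomial σ K)) : Prop :=
  ∀ v ∈ Ω, ∀ j, gradedComponent δ j v ∈ Ω

/-- `m` homogeneous elements generate `Ω`. -/
def HasHomogeneousGenerators (δ : Fin r → ℕ)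
    (Ω : Submodule (MvPolynomial σ K) (Fin r → MvPolynomial σ K)) (m : ℕ) : Prop :=
  ∃ (g : Fin m → Fin r → MvPolynomial σ K) (e : Fin m → ℕ),
    (∀ k, IsShiftedHomogeneous δ (e k) (g k)) ∧
      Submodule.span (MvPolynomial σ K) (Set.range g) = Ω

theorem IsGradedSubmodule.exists_hasHomogeneousGenerators [Finite σ]
    {Ω : Submodule (MvPolynomial σ K) (Fin r → MvPolynomial σ K)}
    (hΩ : IsGradedSubmodule δ Ω) : ∃ m, HasHomogeneousGenerators δ Ω m := by
  set H : Set (Fin r → MvPolynomial σ K) := {v | v ∈ Ω ∧ ∃ j, IsShiftedHomogeneous δ j v}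
  have hspan : Submodule.span (MvPolynomial σ K) H = Ω := by
    refine le_antisymm (Submodule.span_le.2 fun v hv => hv.1) fun v hv => ?_
    obtain ⟨N, hN⟩ := exists_eq_sum_gradedComponent δ v
    rw [hN]
    exact sum_mem fun j _ => Submodule.subset_span
      ⟨hΩ v hv j, j, isShiftedHomogeneous_gradedComponent δ j v⟩
  obtain ⟨S, hSH, hS⟩ := (Submodule.fg_span_iff_fg_span_finset_subset H).1
    (IsNoetherian.noetherian (Submodule.span (MvPolynomial σ K) H))
  have hmem : ∀ k, (S.equivFin.symm k : Fin r → MvPolynomial σ K) ∈ H :=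
    fun k => hSH (S.equivFin.symm k).2
  choose e he using fun k => (hmem k).2
  refine ⟨S.card, fun k => S.equivFin.symm k, e, he, ?_⟩
  rw [← hspan, hS]
  congr 1
  ext v
  constructor
  · rintro ⟨k, rfl⟩
    exact (S.equivFin.symm k).2
  · exact fun hv => ⟨S.equivFin ⟨v, hv⟩, by simp⟩

theorem gradedComponent_linearCombination {m : ℕ} {g : Fin m → Fin r → MvPolynomial σ K}
    {e : Fin m → ℕ} (hg : ∀ k, IsShiftedHomogeneous δ (e k) (g k)) (j : ℕ)
    (v : Fin m → MvPolynomial σ K) :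
    gradedComponent δ j (Fintype.linearCombination (MvPolynomial σ K) g v) =
      Fintype.linearCombination (MvPolynomial σ K) g (gradedComponent e j v) := by
  rw [Fintype.linearCombination_apply, Fintype.linearCombination_apply, map_sum]
  exact Finset.sum_congr rfl fun k _ => gradedComponent_smul (hg k) j (v k)

/-- Graded Nakayama by hand: the component of degree `e k` of a syzygy is a syzygy whose `k`-th
entry is the constant term of `v k`. If that is nonzero, `g k` is a combination of the other
generators, against the minimality of `m`. -/
theorem HasHomogeneousGenerators.constantCoeff_eq_zero {m : ℕ}
    {Ω : Submodule (MvPolynomial σ K) (Fin r → MvPolynomial σ K)}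
    (hmin : ∀ m' < m, ¬ HasHomogeneousGenerators δ Ω m')
    {g : Fin m → Fin r → MvPolynomial σ K} {e : Fin m → ℕ}
    (hg : ∀ k, IsShiftedHomogeneous δ (e k) (g k))
    (hspan : Submodule.span (MvPolynomial σ K) (Set.range g) = Ω)
    {v : Fin m → MvPolynomial σ K}
    (hv : Fintype.linearCombination (MvPolynomial σ K) g v = 0) (k : Fin m) :
    constantCoeff (v k) = 0 := by
  by_contra hk
  obtain _ | m := m
  · exact k.elim0
  refine hmin m (Nat.lt_succ_self m) ⟨g ∘ k.succAbove, e ∘ k.succAbove, fun i => hg _, ?_⟩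
  have h := gradedComponent_linearCombination hg (e k) v
  rw [hv, map_zero, Fintype.linearCombination_apply, Fin.sum_univ_succAbove _ k] at h
  have hC : gradedComponent e (e k) v k = C (constantCoeff (v k)) := by
    rw [gradedComponent_apply, shiftedComponent, if_pos le_rfl, Nat.sub_self,
      homogeneousComponent_zero, constantCoeff_eq]
  have hmem : g k ∈ Submodule.span (MvPolynomial σ K) (Set.range (g ∘ k.succAbove)) := by
    have h1 : (C (constantCoeff (v k)) : MvPolynomial σ K) • g k ∈
        Submodule.span (MvPolynomial σ K) (Set.range (g ∘ k.succAbove)) := by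
      rw [hC] at h
      rw [eq_neg_of_add_eq_zero_left h.symm]
      exact neg_mem (sum_mem fun i _ => Submodule.smul_mem _ _ (Submodule.subset_span ⟨i, rfl⟩))
    have h2 := Submodule.smul_mem _ (C (constantCoeff (v k))⁻¹ : MvPolynomial σ K) h1
    rwa [smul_smul, ← C_mul, inv_mul_cancel₀ hk, C_1, one_smul] at h2
  rw [← hspan]
  refine le_antisymm (Submodule.span_mono (Set.range_comp_subset_range _ _))
    (Submodule.span_le.2 ?_)
  rintro _ ⟨i, rfl⟩
  obtain rfl | hi := eq_or_ne i k
  · exact hmem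
  · obtain ⟨i, rfl⟩ := Fin.exists_succAbove_eq hi
    exact Submodule.subset_span ⟨i, rfl⟩

/-- A graded submodule of a graded free module of finite rank. -/
structure GradedSubmodule (K : Type u) [Field K] (σ : Type) where
  /-- The rank of the free module. -/
  rank : ℕ
  /-- The degrees of the generators of the free module. -/
  deg : Fin rank → ℕ
  /-- The submodule. -/
  carrier : Submodule (MvPolynomial σ K) (Fin rank → MvPolynomial σ K)
  isGraded : IsGradedSubmodule deg carrier

/-- One step of the resolution: `Nat.find` picks the least number of homogeneous generators, and
their syzygies form the next graded submodule. -/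
theorem GradedSubmodule.exists_minimal_cover [Finite σ] (Ω : GradedSubmodule K σ) :
    ∃ (Ω' : GradedSubmodule K σ)
      (d : (Fin Ω'.rank → MvPolynomial σ K) →ₗ[MvPolynomial σ K] (Fin Ω.rank → MvPolynomial σ K)),
      LinearMap.range d = Ω.carrier ∧ LinearMap.ker d = Ω'.carrier ∧
      (∀ c r, ∀ a ∈ (d (Pi.single c 1) r).support, a.degree + Ω.deg r = Ω'.deg c) ∧
      ∀ v ∈ Ω'.carrier, ∀ k, constantCoeff (v k) = 0 := by
  classical
  have hex := Ω.isGraded.exists_hasHomogeneousGenerators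
  obtain ⟨g, e, hg, hspan⟩ := Nat.find_spec hex
  refine ⟨⟨Nat.find hex, e, LinearMap.ker (Fintype.linearCombination (MvPolynomial σ K) g), ?_⟩,
    Fintype.linearCombination (MvPolynomial σ K) g, ?_, rfl, ?_, ?_⟩
  · intro v hv j
    rw [LinearMap.mem_ker] at hv ⊢
    rw [← gradedComponent_linearCombination hg, hv, map_zero]
  · rw [Fintype.range_linearCombination, hspan]
  · intro c r a ha
    rw [Fintype.linearCombination_apply_single, one_smul] at ha
    exact hg c r a ha
  · exact fun v hv => HasHomogeneousGenerators.constantCoeff_eq_zero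
      (fun m' => Nat.find_min hex) hg hspan hv

/-- Start from `F₀ = R` with kernel `J` and iterate the minimal cover. Minimality of the first
differential is exactly `hJ0`; for the later ones it comes from the choice of generators. -/
theorem MinimalGradedFreeResolution.nonempty_of_homogeneousComponent_mem [Finite σ]
    {J : Ideal (MvPolynomial σ K)} (hJ : ∀ f ∈ J, ∀ j, homogeneousComponent j f ∈ J)
    (hJ0 : ∀ f ∈ J, constantCoeff f = 0) : Nonempty (MinimalGradedFreeResolution J) := by
  choose next d hrange hker hdeg hmin using
    fun Ω : GradedSubmodule K σ => Ω.exists_minimal_cover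
  let aug : (Fin 1 → MvPolynomial σ K) →ₗ[MvPolynomial σ K] (MvPolynomial σ K ⧸ J) :=
    (Submodule.mkQ J).comp (LinearMap.proj 0)
  have haug : ∀ v, aug v = 0 ↔ v 0 ∈ J := fun v => Submodule.Quotient.mk_eq_zero J
  let S : ℕ → GradedSubmodule K σ := fun n => Nat.rec
    ⟨1, fun _ => 0, LinearMap.ker aug, fun v hv j => by
      rw [LinearMap.mem_ker, haug] at hv ⊢
      exact hJ _ hv j⟩ (fun _ => next) n
  refine ⟨⟨fun n => (S n).rank, fun n => (S n).deg, aug, fun n => d (S n),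
    ?_, ?_, ?_, ?_, ?_, ?_⟩⟩
  · exact fun c => ⟨1, isHomogeneous_one _ _, by
      obtain rfl : c = (0 : Fin 1) := Subsingleton.elim (α := Fin 1) _ _
      change Submodule.mkQ J ((Pi.single 0 1 : Fin 1 → MvPolynomial σ K) 0) = _
      rw [Pi.single_eq_same]
      rfl⟩
  · exact fun n c r => hdeg (S n) c r
  · exact fun q => by
      obtain ⟨p, rfl⟩ := Submodule.mkQ_surjective J q
      exact ⟨fun _ => p, rfl⟩
  · exact LinearMap.exact_iff.2 (hrange (S 0)).symm
  · exact fun n => LinearMap.exact_iff.2 ((hker (S n)).trans (hrange (S (n + 1))).symm)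
  · intro n v r
    have hmem : d (S n) v ∈ (S n).carrier := by
      rw [← hrange]
      exact ⟨v, rfl⟩
    obtain _ | n := n
    · obtain rfl : r = (0 : Fin 1) := Subsingleton.elim (α := Fin 1) _ _
      exact hJ0 _ ((haug _).1 hmem)
    · exact hmin (S n) _ hmem r

end GradedResolution

theorem MinimalGradedFreeResolution.totalBetti_eq_rank {K : Type*} [Field K] {σ : Type*}
    {J : Ideal (MvPolynomial σ K)} (F : MinimalGradedFreeResolution J) (i : ℕ) :
    F.totalBetti i = F.rank i := by
  classical
  have h : ∀ j, F.gradedBetti i j = (Finset.univ.filter fun c => F.deg i c = j).card := fun j =>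
    Fintype.card_subtype _
  unfold totalBetti
  simp_rw [h]
  rw [finsum_eq_sum_of_support_subset (s := Finset.univ.image (F.deg i))]
  · rw [← Finset.card_eq_sum_card_image, Finset.card_univ, Fintype.card_fin]
  · intro j hj
    obtain ⟨c, hc⟩ := Finset.card_ne_zero.1 hj
    rw [Finset.mem_filter] at hc
    simpa using ⟨c, hc.2⟩

/-! ### Decomposition of the initial ideal and the two bounds -/

section Crystal

open CrystalLattice CategoryTheory Abelian

universe u

variable (K : Type u) [Field K] (n₁ n₂ : ℕ)

/-- The variables of the first chain. -/
def firstChain : Finset (CrystalLattice n₁ n₂) :=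
  Finset.univ.map ⟨x, fun _ _ => x.inj⟩

/-- The variables of the second chain. -/
def secondChain : Finset (CrystalLattice n₁ n₂) :=
  Finset.univ.map ⟨y, fun _ _ => y.inj⟩

open Classical in
/-- The variables of the first chain, and those of the second chain but its first. -/
def firstChainPlus [NeZero n₂] : Finset (CrystalLattice n₁ n₂) :=
  firstChain n₁ n₂ ∪ (secondChain n₁ n₂).erase (y 0)

open Classical in
/-- The variables of the second chain, and those of the first chain but its first. -/
def secondChainPlus [NeZero n₁] : Finset (CrystalLattice n₁ n₂) :=
  secondChain n₁ n₂ ∪ (firstChain n₁ n₂).erase (x 0)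

variable {n₁ n₂}

theorem mem_firstChain {a : CrystalLattice n₁ n₂} : a ∈ firstChain n₁ n₂ ↔ ∃ p, x p = a := by
  simp [firstChain]
  rfl

theorem mem_secondChain {a : CrystalLattice n₁ n₂} : a ∈ secondChain n₁ n₂ ↔ ∃ q, y q = a := by
  simp [secondChain]
  rfl

theorem mem_firstChainPlus [NeZero n₂] {a : CrystalLattice n₁ n₂} :
    a ∈ firstChainPlus n₁ n₂ ↔ (∃ p, x p = a) ∨ ∃ q, q ≠ 0 ∧ y q = a := by
  simp only [firstChainPlus, Finset.mem_union, Finset.mem_erase, mem_firstChain, mem_secondChain]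
  aesop

theorem mem_secondChainPlus [NeZero n₁] {a : CrystalLattice n₁ n₂} :
    a ∈ secondChainPlus n₁ n₂ ↔ (∃ q, y q = a) ∨ ∃ p, p ≠ 0 ∧ x p = a := by
  simp only [secondChainPlus, Finset.mem_union, Finset.mem_erase, mem_firstChain, mem_secondChain]
  aesop

theorem firstChain_subset [NeZero n₂] : firstChain n₁ n₂ ⊆ firstChainPlus n₁ n₂ := by
  classical exact Finset.subset_union_left

theorem secondChain_subset [NeZero n₁] : secondChain n₁ n₂ ⊆ secondChainPlus n₁ n₂ := by
  classical exact Finset.subset_union_left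

theorem card_firstChain : (firstChain n₁ n₂).card = n₁ := by simp [firstChain]

theorem card_secondChain : (secondChain n₁ n₂).card = n₂ := by simp [secondChain]

variable [NeZero n₁] [NeZero n₂]

omit [NeZero n₁] in
theorem card_firstChainPlus : (firstChainPlus n₁ n₂).card = n₁ + (n₂ - 1) := by
  classical
  rw [firstChainPlus, Finset.card_union_of_disjoint, Finset.card_erase_of_mem, card_firstChain,
    card_secondChain]
  · exact mem_secondChain.2 ⟨0, rfl⟩
  · rw [Finset.disjoint_left]
    intro a ha hb
    obtain ⟨p, rfl⟩ := mem_firstChain.1 ha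
    obtain ⟨q, hq⟩ := mem_secondChain.1 (Finset.mem_of_mem_erase hb)
    exact absurd hq (by simp)

omit [NeZero n₂] in
theorem card_secondChainPlus_le : (secondChainPlus n₁ n₂).card ≤ n₁ + n₂ := by
  classical
  refine (Finset.card_union_le _ _).trans ?_
  rw [card_secondChain, add_comm]
  gcongr
  exact (Finset.card_erase_le).trans card_firstChain.le

/-- All ideals involved are monomial, so the equality is a case check on exponents. The grouping by
chain is the one in which Mayer–Vietoris will be applied. -/
theorem crystalInitialIdeal_eq_inf :
    crystalInitialIdeal K n₁ n₂ =
      ((Ideal.span (X '' (firstChain n₁ n₂ : Set _)) ⊔ Ideal.span {X s * X t}) ⊓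
        Ideal.span (X '' (firstChainPlus n₁ n₂ : Set _))) ⊓
      ((Ideal.span (X '' (secondChain n₁ n₂ : Set _)) ⊔ Ideal.span {X s * X t}) ⊓
        Ideal.span (X '' (secondChainPlus n₁ n₂ : Set _))) := by
  have hst : (s : CrystalLattice n₁ n₂) ≠ t := by simp
  ext f
  simp only [Ideal.mem_inf, mem_crystalInitialIdeal_iff, mem_span_X_image_sup_iff hst,
    mem_ideal_span_X_image, ← forall_and]
  refine forall₂_congr fun m _ => ?_
  simp only [SetLike.mem_coe, mem_firstChain, mem_secondChain, mem_firstChainPlus,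
    mem_secondChainPlus]
  constructor
  · rintro (⟨p, q, hp, hq⟩ | ⟨hs, ht, ⟨p, hp, hp'⟩ | ⟨q, hq, hq'⟩⟩)
    · refine ⟨⟨Or.inl ⟨_, ⟨p, rfl⟩, hp⟩, _, Or.inl ⟨p, rfl⟩, hp⟩,
        Or.inl ⟨_, ⟨q, rfl⟩, hq⟩, _, Or.inl ⟨q, rfl⟩, hq⟩
    · exact ⟨⟨Or.inr ⟨hs, ht⟩, _, Or.inl ⟨p, rfl⟩, hp'⟩, Or.inr ⟨hs, ht⟩,
        _, Or.inr ⟨p, hp, rfl⟩, hp'⟩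
    · exact ⟨⟨Or.inr ⟨hs, ht⟩, _, Or.inr ⟨q, hq, rfl⟩, hq'⟩, Or.inr ⟨hs, ht⟩,
        _, Or.inl ⟨q, rfl⟩, hq'⟩
  · rintro ⟨⟨h1, _, h2, h2'⟩, h3, _, h4, h4'⟩
    rcases h2 with ⟨p, rfl⟩ | ⟨q, hq, rfl⟩ <;> rcases h4 with ⟨q', rfl⟩ | ⟨p', hp', rfl⟩
    · exact Or.inl ⟨p, q', h2', h4'⟩
    · rcases h3 with ⟨_, ⟨q', rfl⟩, h3⟩ | ⟨hs, ht⟩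
      · exact Or.inl ⟨p, q', h2', h3⟩
      · exact Or.inr ⟨hs, ht, Or.inl ⟨p', hp', h4'⟩⟩
    · rcases h1 with ⟨_, ⟨p, rfl⟩, h1⟩ | ⟨hs, ht⟩
      · exact Or.inl ⟨p, q, h1, h2'⟩
      · exact Or.inr ⟨hs, ht, Or.inr ⟨q, hq, h2'⟩⟩
    · exact Or.inl ⟨p', q, h4', h2'⟩

theorem hasProjectiveDimensionLT_crystalInitialIdeal :
    HasProjectiveDimensionLT (ModuleCat.of (MvPolynomial (CrystalLattice n₁ n₂) K)
      (MvPolynomial (CrystalLattice n₁ n₂) K ⧸ crystalInitialIdeal K n₁ n₂)) (n₁ + n₂ + 2) := by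
  classical
  -- The two groups add up to the ideal of all chain variables: each contains its own chain and lies
  -- in an ideal generated by chain variables.
  have hsup : ((Ideal.span (X '' (firstChain n₁ n₂ : Set _)) ⊔ Ideal.span {X s * X t}) ⊓
      Ideal.span (X '' (firstChainPlus n₁ n₂ : Set _))) ⊔
    ((Ideal.span (X '' (secondChain n₁ n₂ : Set _)) ⊔ Ideal.span {X s * X t}) ⊓
      Ideal.span (X '' (secondChainPlus n₁ n₂ : Set _))) =
    (Ideal.span (X '' ((firstChain n₁ n₂ ∪ secondChain n₁ n₂ : Finset _) : Set _)) :
      Ideal (MvPolynomial (CrystalLattice n₁ n₂) K)) := by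
    have hplus : ∀ T T' : Finset (CrystalLattice n₁ n₂), T ⊆ T' →
        (Ideal.span (X '' (T : Set _)) : Ideal (MvPolynomial (CrystalLattice n₁ n₂) K)) ≤
          Ideal.span (X '' (T' : Set _)) :=
      fun T T' h => Ideal.span_mono (Set.image_mono h)
    apply le_antisymm
    · refine sup_le (inf_le_right.trans (hplus _ _ ?_)) (inf_le_right.trans (hplus _ _ ?_))
      · exact Finset.union_subset_union_right (Finset.erase_subset _ _)
      · rw [Finset.union_comm (firstChain n₁ n₂)]
        exact Finset.union_subset_union_right (Finset.erase_subset _ _)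
    · rw [Finset.coe_union, Set.image_union, Ideal.span_union]
      exact sup_le_sup (le_inf le_sup_left (hplus _ _ Finset.subset_union_left))
        (le_inf le_sup_left (hplus _ _ Finset.subset_union_left))
  rw [crystalInitialIdeal_eq_inf]
  refine hasProjectiveDimensionLT_quotient_inf hsup
    (hasProjectiveDimensionLT_quotient_span_X_sup_inf (by simp [mem_firstChainPlus])
      (by simp [mem_firstChainPlus]) firstChain_subset ?_)
    (hasProjectiveDimensionLT_quotient_span_X_sup_inf (by simp [mem_secondChainPlus])
      (by simp [mem_secondChainPlus]) secondChain_subset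
      (Nat.lt_succ_of_le card_secondChainPlus_le))
    (hasProjectiveDimensionLT_quotient_span_X_of_lt _ ?_)
  · rw [card_firstChainPlus]
    omega
  · have hle := Finset.card_union_le (firstChain n₁ n₂) (secondChain n₁ n₂)
    rw [card_firstChain, card_secondChain] at hle
    omega

open Classical in
/-- The point with coordinates `1` in `s`, `t` and `y 0`, and `0` elsewhere. -/
def testPoint (K : Type u) [Field K] (n₁ n₂ : ℕ) [NeZero n₂] (a : CrystalLattice n₁ n₂) : K :=
  if a ∈ firstChainPlus n₁ n₂ then 0 else 1

/-- The residue field of the test point. -/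
abbrev testModule (K : Type u) [Field K] (n₁ n₂ : ℕ) [NeZero n₂] :
    ModuleCat.{u} (MvPolynomial (CrystalLattice n₁ n₂) K) :=
  ModuleCat.of _ (MvPolynomial (CrystalLattice n₁ n₂) K ⧸ RingHom.ker (eval (testPoint K n₁ n₂)))

instance isSimpleModule_testModule :
    IsSimpleModule (MvPolynomial (CrystalLattice n₁ n₂) K) (testModule K n₁ n₂) := by
  have : (RingHom.ker (eval (testPoint K n₁ n₂))).IsMaximal :=
    RingHom.ker_isMaximal_of_surjective _ fun c => ⟨C c, eval_C c⟩
  exact isSimpleModule_iff_isCoatom.2 (Ideal.isMaximal_def.1 this)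

variable {K}

omit [NeZero n₁] in
theorem smul_testModule_eq {f g : MvPolynomial (CrystalLattice n₁ n₂) K}
    (h : eval (testPoint K n₁ n₂) f = eval (testPoint K n₁ n₂) g) (n : testModule K n₁ n₂) :
    f • n = g • n := by
  obtain ⟨n, rfl⟩ := Ideal.Quotient.mk_surjective n
  refine Ideal.Quotient.eq.2 ?_
  rw [RingHom.mem_ker]
  simp [h]

/-- The element `s t y_0` takes the value `1` at the test point and multiplies every variable of
`firstChainPlus` into the initial ideal: `s t y_0 x_p` is a multiple of `x_p y_0`, and `s t y_0 y_q`
of `s t y_q`. -/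
theorem choose_le_length_ext_crystalInitialIdeal (i : ℕ) :
    ((n₁ + (n₂ - 1)).choose i : ℕ∞) ≤ Module.length (MvPolynomial (CrystalLattice n₁ n₂) K)
      (Ext (ModuleCat.of (MvPolynomial (CrystalLattice n₁ n₂) K)
        (MvPolynomial (CrystalLattice n₁ n₂) K ⧸ crystalInitialIdeal K n₁ n₂))
        (testModule K n₁ n₂) i) := by
  rw [← card_firstChainPlus (n₁ := n₁) (n₂ := n₂)]
  refine (choose_le_length_ext_quotient_span_X _ _ (fun k hk n => ?_) i).trans
    (length_ext_quotient_le_of_mul_mem (f := X s * X t * X (y 0)) ?_ ?_ (fun n => ?_) i)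
  · rw [smul_testModule_eq (g := 0) (by simp [testPoint, hk]), zero_smul]
  · rw [crystalInitialIdeal_eq_inf]
    exact inf_le_left.trans inf_le_right
  · intro p hp
    induction hp using Submodule.span_induction with
    | zero => simp
    | add p q _ _ hp hq => rw [mul_add]; exact add_mem hp hq
    | smul a p _ hp => rw [smul_eq_mul, mul_left_comm]; exact Ideal.mul_mem_left _ _ hp
    | mem p hp =>
      obtain ⟨k, hk, rfl⟩ := hp
      rw [mem_crystalInitialIdeal_iff]
      intro m hm
      simp only [X, monomial_mul, mul_one] at hm
      rw [Finset.mem_singleton.1 (support_monomial_subset hm)]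
      rcases mem_firstChainPlus.1 hk with ⟨p, rfl⟩ | ⟨q, hq, rfl⟩
      · exact Or.inl ⟨p, 0, by simp, by simp⟩
      · exact Or.inr ⟨by simp, by simp, Or.inr ⟨q, hq, by simp⟩⟩
  · rw [smul_testModule_eq (g := 1) (by simp [testPoint, mem_firstChainPlus]), one_smul]

end Crystal

end

theorem theorem1 (K : Type*) [Field K] (n₁ n₂ : ℕ) (hn₁ : 0 < n₁) (hn₂ : 0 < n₂) :
    (((max n₁ n₂ : ℕ) : WithBot ℕ∞) ≤
        CategoryTheory.projectiveDimension
          (ModuleCat.of (MvPolynomial (CrystalLattice n₁ n₂) K)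
            (MvPolynomial (CrystalLattice n₁ n₂) K ⧸ crystalInitialIdeal K n₁ n₂)) ∧
      CategoryTheory.projectiveDimension
          (ModuleCat.of (MvPolynomial (CrystalLattice n₁ n₂) K)
            (MvPolynomial (CrystalLattice n₁ n₂) K ⧸ crystalInitialIdeal K n₁ n₂)) ≤
        ((n₁ + n₂ + 1 : ℕ) : WithBot ℕ∞)) ∧
    Nonempty (MinimalGradedFreeResolution (crystalInitialIdeal K n₁ n₂)) ∧
    ∀ F : MinimalGradedFreeResolution (crystalInitialIdeal K n₁ n₂),
      ∀ i ∈ Finset.Icc 1 n₁, n₁.choose i ≤ F.totalBetti i := by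
  have : NeZero n₁ := ⟨hn₁.ne'⟩
  have : NeZero n₂ := ⟨hn₂.ne'⟩
  refine ⟨⟨?_, ?_⟩, ?_, fun F i _ => ?_⟩
  -- As both `n₁` and `n₂` are positive, `n₁ + n₂ - 1` is at least their maximum. It is the top
  -- degree in which the binomial bound forces Ext to be nonzero.
  · refine le_trans (b := ((n₁ + (n₂ - 1) : ℕ) : WithBot ℕ∞)) (by norm_cast; omega) ?_
    rw [CategoryTheory.projectiveDimension_ge_iff]
    intro h
    have hsub := h.subsingleton _ _ (n₁ + (n₂ - 1)) le_rfl (testModule K n₁ n₂)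
    have hlen := choose_le_length_ext_crystalInitialIdeal (K := K) (n₁ := n₁) (n₂ := n₂)
      (n₁ + (n₂ - 1))
    rw [Module.length_eq_zero, Nat.choose_self] at hlen
    simp at hlen
  · rw [CategoryTheory.projectiveDimension_le_iff]
    exact hasProjectiveDimensionLT_crystalInitialIdeal K
  · refine MinimalGradedFreeResolution.nonempty_of_homogeneousComponent_mem ?_ ?_
    · intro f hf j
      rw [mem_crystalInitialIdeal_iff] at hf ⊢
      intro m hm
      rw [support_homogeneousComponent, Finset.mem_filter] at hm
      exact hf m hm.1
    · intro f hf
      rw [mem_crystalInitialIdeal_iff] at hf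
      rw [constantCoeff_eq]
      by_contra h
      simpa [CrystalLattice.IsInitialExponent] using hf 0 (mem_support_iff.2 h)
  · rw [F.totalBetti_eq_rank]
    have h := (choose_le_length_ext_crystalInitialIdeal (K := K) (n₁ := n₁) (n₂ := n₂) i).trans
      (ModuleCat.length_ext_le_rank (testModule K n₁ n₂) i _ F.rank F.aug F.d F.aug_surjective
        F.exact_zero F.exact_succ)
    exact (Nat.choose_le_choose i (Nat.le_add_right n₁ (n₂ - 1))).trans (by exact_mod_cast h)
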